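/- Fix $a \in [0,1)$ and $b \in (0,1]$. For every integer $n \ge 1$ let $J_x, J_y, J_z$ be the generators of an irreducible unitary $n$-dimensional representation of $SU(2)$, that is, self-adjoint operators on an $n$-dimensional complex inner product space that satisfy $$[J_x,J_y] = iJ_z,\qquad [J_y,J_z] = iJ_x,\qquad [J_z,J_x] = iJ_y$$ and have no common invariant subspace other than $0$ and the whole space. Let $j = \frac{n-1}{2}$ be the spin number. For a self-adjoint operator $A$ and a set $I \subset \mathbb{R}$ let $\mathbb{1}_I(A)$ denote the spectral projection, i.e. the orthogonal projection onto the span of the eigenvectors of $A$ with eigenvalue in $I$, and put $$C_{n,a,b} = \left[\mathbb{1}_{\left(a\left(j+\frac12\right),\,\infty\right)}(J_x),\ \mathbb{1}_{\left(0,\,b\left(j+\frac12\right)\right]}(J_z)\right],$$ where $[S,T] = ST - TS$. Then $$\lim_{n\to\infty} \left\Vert C_{n,a,b} \right\Vert_{\mathrm{op}} = \frac12 .$$ -/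

import Mathlib

/-- `Jx`, `Jy`, `Jz` are the generators of an irreducible unitary representation of `SU(2)` on the
complex inner product space `V` (in infinitesimal form): self-adjoint operators
that satisfy `[Jx, Jy] = i Jz`, `[Jy, Jz] = i Jx`, `[Jz, Jx] = i Jy` and whose only common invariant
subspaces are `0` and `V`, where `V ≠ 0`. -/
structure IsIrreducibleSpin {V : Type*} [NormedAddCommGroup V] [InnerProductSpace ℂ V]
    (Jx Jy Jz : V →ₗ[ℂ] V) : Prop where
  nontrivial : Nontrivial V
  symm_x : Jx.IsSymmetric
  symm_y : Jy.IsSymmetric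
  symm_z : Jz.IsSymmetric
  comm_xy : Jx * Jy - Jy * Jx = Complex.I • Jz
  comm_yz : Jy * Jz - Jz * Jy = Complex.I • Jx
  comm_zx : Jz * Jx - Jx * Jz = Complex.I • Jy
  irreducible : ∀ W : Submodule ℂ V,
    (∀ v ∈ W, Jx v ∈ W) → (∀ v ∈ W, Jy v ∈ W) → (∀ v ∈ W, Jz v ∈ W) → W = ⊥ ∨ W = ⊤

/-- The spectral projection `𝟙_I(A)` of a self-adjoint operator `A` on a finite-dimensional complex
inner product space: the orthogonal projection onto the span of all eigenvectors of `A` whose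
eigenvalue lies in `I`. -/
noncomputable def spectralProjection {V : Type*} [NormedAddCommGroup V] [InnerProductSpace ℂ V]
    [FiniteDimensional ℂ V] (A : V →ₗ[ℂ] V) (I : Set ℝ) : V →L[ℂ] V :=
  (⨆ μ ∈ I, Module.End.eigenspace A (μ : ℂ)).starProjection

/-- The spin number `j = (n - 1) / 2` of the `n`-dimensional irreducible representation. -/
noncomputable def spinNumber (n : ℕ) : ℝ := ((n : ℝ) - 1) / 2

/-- The commutator of `𝟙_{(a(j+1/2), ∞)}(Jx)` and `𝟙_{(0, b(j+1/2)]}(Jz)`, where `j` is the spin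
number in dimension `dim V`. -/
noncomputable def spinCommutator {V : Type*} [NormedAddCommGroup V] [InnerProductSpace ℂ V]
    [FiniteDimensional ℂ V] (a b : ℝ) (Jx Jz : V →ₗ[ℂ] V) : V →L[ℂ] V :=
  let j := spinNumber (Module.finrank ℂ V)
  let P := spectralProjection Jx (Set.Ioi (a * (j + 1 / 2)))
  let Q := spectralProjection Jz (Set.Ioc 0 (b * (j + 1 / 2)))
  P * Q - Q * P

/-!
A commutator of two orthogonal projections has norm at most `1 / 2`, so only the lower bound
requires work. In a weight basis around the equator, where the eigenvalues of `Jz` change sign,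
`Jx / (n / 2)` is a tridiagonal matrix whose entries converge to those of multiplication by `cos θ`
in the Fourier basis. Hence the matrix entries of the spectral projection of `Jx` converge to the
Fourier coefficients `sin ((k - m) α) / (π (k - m))`, `α = arccos a`, of an arc of the circle, while
the projection of `Jz` keeps precisely the basis vectors of negative index. The off-diagonal block
of the limit is a Hankel operator. Testing it on `1 / √(k + 1)` with suitable phases, the Hilbert
matrix divided by `2 π` remains up to bounded terms; the Hilbert matrix has norm `π`, attained
asymptotically by `1 / √(k + 1)`, and the squared norm `∑ 1 / (k + 1)` of the test vectors diverges,
so every number below `1 / 2` is eventually exceeded.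
-/

open Filter Module Polynomial Topology
open scoped InnerProductSpace

/-! ### Orthogonal projections and spectral projections -/

section Projections

variable {𝕜 E : Type*} [RCLike 𝕜] [NormedAddCommGroup E] [InnerProductSpace 𝕜 E]

theorem norm_two_smul_starProjection_sub_one_le (U : Submodule 𝕜 E) [U.HasOrthogonalProjection] :
    ‖(2 : 𝕜) • U.starProjection - 1‖ ≤ 1 := by
  have h : (2 : 𝕜) • U.starProjection - 1 = (U.reflection : E →L[𝕜] E) := by
    ext x
    simp [Submodule.reflection_apply, two_smul]
  rw [h]
  exact U.reflection.toLinearIsometry.norm_toContinuousLinearMap_le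

theorem norm_commutator_starProjection_le (U W : Submodule 𝕜 E) [U.HasOrthogonalProjection]
    [W.HasOrthogonalProjection] :
    ‖U.starProjection * W.starProjection - W.starProjection * U.starProjection‖ ≤ 1 / 2 := by
  set S := (2 : 𝕜) • U.starProjection - 1 with hS
  set T := (2 : 𝕜) • W.starProjection - 1 with hT
  have hS1 : ‖S‖ ≤ 1 := norm_two_smul_starProjection_sub_one_le U
  have hT1 : ‖T‖ ≤ 1 := norm_two_smul_starProjection_sub_one_le W
  have hST : U.starProjection * W.starProjection - W.starProjection * U.starProjection
      = (1 / 4 : 𝕜) • (S * T - T * S) := by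
    rw [hS, hT]
    simp only [sub_mul, mul_sub, smul_mul_assoc, mul_smul_comm, one_mul, mul_one]
    module
  calc ‖U.starProjection * W.starProjection - W.starProjection * U.starProjection‖
      = 1 / 4 * ‖S * T - T * S‖ := by rw [hST, norm_smul]; norm_num
    _ ≤ 1 / 4 * (‖S‖ * ‖T‖ + ‖T‖ * ‖S‖) := by
      gcongr
      exact (norm_sub_le _ _).trans (add_le_add (norm_mul_le _ _) (norm_mul_le _ _))
    _ ≤ 1 / 4 * (1 * 1 + 1 * 1) := by gcongr
    _ = 1 / 2 := by norm_num

theorem norm_inner_le_norm_commutator_mul {P Q : E →L[𝕜] E} {x y : E} (hQ : Q.IsSymmetric)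
    (hx : Q x = 0) (hy : Q y = y) : ‖⟪x, P y⟫_𝕜‖ ≤ ‖P * Q - Q * P‖ * (‖x‖ * ‖y‖) := by
  have hQP : ⟪x, Q (P y)⟫_𝕜 = 0 := by
    rw [← ContinuousLinearMap.coe_coe Q, ← hQ x (P y), ContinuousLinearMap.coe_coe, hx,
      inner_zero_left]
  calc ‖⟪x, P y⟫_𝕜‖ = ‖⟪x, (P * Q - Q * P) y⟫_𝕜‖ := by
        simp [inner_sub_right, hy, hQP]
    _ ≤ ‖x‖ * (‖P * Q - Q * P‖ * ‖y‖) :=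
      (norm_inner_le_norm _ _).trans (by gcongr; exact ContinuousLinearMap.le_opNorm _ _)
    _ = ‖P * Q - Q * P‖ * (‖x‖ * ‖y‖) := by ring

section Diagonal

variable {ι : Type*} [Fintype ι] (b : OrthonormalBasis ι 𝕜 E) {S T : E →ₗ[𝕜] E} {s : ι → ℝ}
  {t : ι → 𝕜}

theorem inner_apply_eq_sum_of_apply_eq_smul (hT : ∀ i, T (b i) = t i • b i) (x y : E) :
    ⟪x, T y⟫_𝕜 = ∑ i, t i * (⟪x, b i⟫_𝕜 * ⟪b i, y⟫_𝕜) := by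
  conv_lhs => rw [← b.sum_repr' y, map_sum, inner_sum]
  refine Finset.sum_congr rfl fun i _ => ?_
  rw [map_smul, hT, inner_smul_right, inner_smul_right]
  ring

theorem norm_inner_apply_le_of_norm_le (hT : ∀ i, T (b i) = t i • b i)
    (hS : ∀ i, S (b i) = (s i : 𝕜) • b i) (hts : ∀ i, ‖t i‖ ≤ s i) (x y : E) :
    ‖⟪x, T y⟫_𝕜‖ ≤ (‖⟪x, S x⟫_𝕜‖ + ‖⟪y, S y⟫_𝕜‖) / 2 := by
  have hs : ∀ i, 0 ≤ s i := fun i => (norm_nonneg _).trans (hts i)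
  have norm_inner_S : ∀ z, ‖⟪z, S z⟫_𝕜‖ = ∑ i, s i * ‖⟪b i, z⟫_𝕜‖ ^ 2 := by
    intro z
    have h : ⟪z, S z⟫_𝕜 = ((∑ i, s i * ‖⟪b i, z⟫_𝕜‖ ^ 2 : ℝ) : 𝕜) := by
      rw [inner_apply_eq_sum_of_apply_eq_smul b hS]
      push_cast
      exact Finset.sum_congr rfl fun i _ => by rw [← inner_conj_symm z (b i), RCLike.conj_mul]
    rw [h, RCLike.norm_of_nonneg]
    exact Finset.sum_nonneg fun i _ => mul_nonneg (hs i) (sq_nonneg _)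
  rw [inner_apply_eq_sum_of_apply_eq_smul b hT, norm_inner_S, norm_inner_S,
    ← Finset.sum_add_distrib, Finset.sum_div]
  refine (norm_sum_le _ _).trans (Finset.sum_le_sum fun i _ => ?_)
  calc ‖t i * (⟪x, b i⟫_𝕜 * ⟪b i, y⟫_𝕜)‖
      = ‖t i‖ * (‖⟪b i, x⟫_𝕜‖ * ‖⟪b i, y⟫_𝕜‖) := by rw [norm_mul, norm_mul, norm_inner_symm x]
    _ ≤ s i * ((‖⟪b i, x⟫_𝕜‖ ^ 2 + ‖⟪b i, y⟫_𝕜‖ ^ 2) / 2) := by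
      gcongr
      · exact hs i
      · exact hts i
      · linarith [two_mul_le_add_sq ‖⟪b i, x⟫_𝕜‖ ‖⟪b i, y⟫_𝕜‖]
    _ = _ := by ring

end Diagonal

end Projections

section SpectralProjection

variable {V : Type*} [NormedAddCommGroup V] [InnerProductSpace ℂ V]

theorem aeval_apply_of_apply_eq_smul {A : V →ₗ[ℂ] V} {μ : ℝ} {x : V} (hx : A x = (μ : ℂ) • x)
    (p : ℝ[X]) : aeval A p x = ((p.eval μ : ℝ) : ℂ) • x := by
  induction p using Polynomial.induction_on' with
  | add p q hp hq =>
    rw [map_add, LinearMap.add_apply, hp, hq, eval_add, Complex.ofReal_add, add_smul]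
  | monomial k r =>
    have hpow : (A ^ k) x = (μ : ℂ) ^ k • x := by
      induction k with
      | zero => simp
      | succ k ih => rw [pow_succ', End.mul_apply, ih, map_smul, hx, smul_smul, pow_succ]
    rw [aeval_monomial, End.mul_apply, hpow, eval_monomial, Module.algebraMap_end_apply,
      ← Complex.coe_smul, smul_smul]
    push_cast
    rfl

variable [FiniteDimensional ℂ V] {A : V →ₗ[ℂ] V} {I : Set ℝ} {μ : ℝ}

theorem spectralProjection_apply_of_mem (hμ : μ ∈ I) {x : V} (hx : A x = (μ : ℂ) • x) :
    spectralProjection A I x = x := by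
  have hle : End.eigenspace A (μ : ℂ) ≤ ⨆ ν ∈ I, End.eigenspace A (ν : ℂ) :=
    le_iSup₂_of_le (f := fun (ν : ℝ) (_ : ν ∈ I) => End.eigenspace A (ν : ℂ)) μ hμ le_rfl
  exact Submodule.starProjection_eq_self_iff.mpr (hle (End.mem_eigenspace_iff.mpr hx))

theorem spectralProjection_apply_of_notMem (hA : A.IsSymmetric) (hμ : μ ∉ I) {x : V}
    (hx : A x = (μ : ℂ) • x) : spectralProjection A I x = 0 := by
  have hle : ⨆ ν ∈ I, End.eigenspace A (ν : ℂ) ≤ (ℂ ∙ x)ᗮ := by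
    refine iSup₂_le fun ν hν y hy => ?_
    have hne : (μ : ℂ) ≠ (ν : ℂ) := fun h => hμ (by rwa [Complex.ofReal_inj.mp h])
    rw [Submodule.mem_orthogonal_singleton_iff_inner_right]
    exact hA.orthogonalFamily_eigenspaces hne ⟨x, End.mem_eigenspace_iff.mpr hx⟩ ⟨y, hy⟩
  exact (Submodule.starProjection_apply_eq_zero_iff _).mpr fun y hy =>
    Submodule.mem_orthogonal_singleton_iff_inner_left.mp (hle hy)

theorem spectralProjection_apply_of_apply_eq_smul (hA : A.IsSymmetric) {x : V}
    (hx : A x = (μ : ℂ) • x) :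
    spectralProjection A I x = ((I.indicator 1 μ : ℝ) : ℂ) • x := by
  by_cases hμ : μ ∈ I
  · simp [hμ, spectralProjection_apply_of_mem hμ hx]
  · simp [hμ, spectralProjection_apply_of_notMem hA hμ hx]

theorem spectralProjection_smul {c : ℝ} (hc : c ≠ 0) (A : V →ₗ[ℂ] V) (I : Set ℝ) :
    spectralProjection ((c : ℂ) • A) I = spectralProjection A ((c * ·) ⁻¹' I) := by
  have heig : ∀ ν : ℝ, End.eigenspace ((c : ℂ) • A) ((c * ν : ℝ) : ℂ) =
      End.eigenspace A (ν : ℂ) := by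
    intro ν
    ext x
    have hc' : (c : ℂ) ≠ 0 := Complex.ofReal_ne_zero.mpr hc
    rw [End.mem_eigenspace_iff, End.mem_eigenspace_iff, LinearMap.smul_apply, Complex.ofReal_mul,
      mul_smul, smul_right_inj hc']
  have hsup : ⨆ μ ∈ I, End.eigenspace ((c : ℂ) • A) (μ : ℂ) =
      ⨆ ν ∈ (c * ·) ⁻¹' I, End.eigenspace A (ν : ℂ) := by
    simp only [Set.mem_preimage, ← heig]
    exact ((mul_left_surjective₀ hc).iSup_comp
      fun μ => ⨆ _ : μ ∈ I, End.eigenspace ((c : ℂ) • A) (μ : ℂ)).symm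
  unfold spectralProjection
  congr 1

theorem norm_inner_spectralProjection_sub_aeval_le (hA : A.IsSymmetric) {p q : ℝ[X]}
    (hpq : ∀ μ : ℝ, End.HasEigenvalue A (μ : ℂ) → |I.indicator 1 μ - p.eval μ| ≤ q.eval μ)
    (x y : V) :
    ‖⟪x, spectralProjection A I y⟫_ℂ - ⟪x, aeval A p y⟫_ℂ‖ ≤
      (‖⟪x, aeval A q x⟫_ℂ‖ + ‖⟪y, aeval A q y⟫_ℂ‖) / 2 := by
  set b := hA.eigenvectorBasis rfl
  set ν := hA.eigenvalues rfl
  have heig : ∀ i, A (b i) = (ν i : ℂ) • b i := hA.apply_eigenvectorBasis rfl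
  have hsub : ∀ i, (↑(spectralProjection A I) - aeval A p) (b i) =
      ((I.indicator 1 (ν i) - p.eval (ν i) : ℝ) : ℂ) • b i := fun i => by
    rw [LinearMap.sub_apply, ContinuousLinearMap.coe_coe,
      spectralProjection_apply_of_apply_eq_smul hA (heig i), aeval_apply_of_apply_eq_smul (heig i),
      ← sub_smul, ← Complex.ofReal_sub]
  rw [← inner_sub_right]
  refine norm_inner_apply_le_of_norm_le b hsub
    (fun i => aeval_apply_of_apply_eq_smul (heig i) q) (fun i => ?_) x y
  rw [Complex.norm_real, Real.norm_eq_abs]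
  exact hpq _ (hA.hasEigenvalue_eigenvalues rfl i)

end SpectralProjection

/-! ### Irreducible representations of `SU(2)` -/

/-- The raising operator `J₊ = Jx + i Jy`. -/
noncomputable def raising {V : Type*} [AddCommGroup V] [Module ℂ V] (Jx Jy : V →ₗ[ℂ] V) :
    End ℂ V :=
  Jx + Complex.I • Jy

/-- The lowering operator `J₋ = Jx - i Jy`. -/
noncomputable def lowering {V : Type*} [AddCommGroup V] [Module ℂ V] (Jx Jy : V →ₗ[ℂ] V) :
    End ℂ V :=
  Jx - Complex.I • Jy

/-- The matrix entry of `Jx` between the weight vectors number `i` and `i + 1`, counted from the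
highest weight, in the `n`-dimensional irreducible representation. -/
noncomputable def ladderCoeff (n i : ℕ) : ℝ := √((i + 1) * (n - 1 - i)) / 2

/-- `v 0, v 1, …` is the standard basis of weight vectors of a spin representation, ordered by
decreasing weight: `Jz` is diagonal and `Jx` is a Jacobi matrix. The sequence is indexed by `ℕ`,
but only the terms `v i` with `i < dim V` belong to the basis. -/
structure IsWeightBasis {V : Type*} [NormedAddCommGroup V] [InnerProductSpace ℂ V]
    (Jx Jz : V →ₗ[ℂ] V) (v : ℕ → V) : Prop where
  orthonormal : Orthonormal ℂ fun i : Fin (finrank ℂ V) => v i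
  apply_z : ∀ i : ℕ, Jz (v i) = ((spinNumber (finrank ℂ V) - i : ℝ) : ℂ) • v i
  apply_x : ∀ i : ℕ, Jx (v (i + 1)) = (ladderCoeff (finrank ℂ V) i : ℂ) • v i +
    (ladderCoeff (finrank ℂ V) (i + 1) : ℂ) • v (i + 2)

section Ladder

variable {V : Type*} [AddCommGroup V] [Module ℂ V] (Jx Jy : V →ₗ[ℂ] V)

theorem raising_add_lowering : raising Jx Jy + lowering Jx Jy = (2 : ℂ) • Jx := by
  rw [raising, lowering]
  module

theorem raising_sub_lowering : raising Jx Jy - lowering Jx Jy = (2 * Complex.I) • Jy := by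
  rw [raising, lowering]
  module

end Ladder

namespace IsIrreducibleSpin

attribute [local instance] LieRing.ofAssociativeRing

variable {V : Type*} [NormedAddCommGroup V] [InnerProductSpace ℂ V] {Jx Jy Jz : V →ₗ[ℂ] V}

theorem cyclic (h : IsIrreducibleSpin Jx Jy Jz) : IsIrreducibleSpin Jy Jz Jx :=
  ⟨h.nontrivial, h.symm_y, h.symm_z, h.symm_x, h.comm_yz, h.comm_zx, h.comm_xy,
    fun W hx hy hz => h.irreducible W hz hx hy⟩

theorem inner_lowering_left (h : IsIrreducibleSpin Jx Jy Jz) (x y : V) :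
    ⟪lowering Jx Jy x, y⟫_ℂ = ⟪x, raising Jx Jy y⟫_ℂ := by
  simp only [raising, lowering, LinearMap.add_apply, LinearMap.sub_apply, LinearMap.smul_apply,
    inner_add_right, inner_sub_left, inner_smul_left, inner_smul_right, h.symm_x x y,
    h.symm_y x y, Complex.conj_I]
  ring

theorem z_ne_zero (h : IsIrreducibleSpin Jx Jy Jz) (hn : 1 < finrank ℂ V) : Jz ≠ 0 := by
  intro hz
  have hx : Jx = 0 := by simpa [hz] using h.comm_yz.symm
  have hy : Jy = 0 := by simpa [hz] using h.comm_zx.symm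
  have := h.nontrivial
  obtain ⟨v, hv⟩ := exists_ne (0 : V)
  have hline : (ℂ ∙ v) = ⊤ := (h.irreducible (ℂ ∙ v) (by simp [hx]) (by simp [hy])
    (by simp [hz])).resolve_left (by simpa using hv)
  have : finrank ℂ V = 1 := by rw [← finrank_top, ← hline, finrank_span_singleton hv]
  exact hn.ne' this

theorem eq_top_of_invariant (h : IsIrreducibleSpin Jx Jy Jz) {W : Submodule ℂ V} (hW : W ≠ ⊥)
    (hraise : ∀ x ∈ W, raising Jx Jy x ∈ W) (hlower : ∀ x ∈ W, lowering Jx Jy x ∈ W)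
    (hz : ∀ x ∈ W, Jz x ∈ W) : W = ⊤ := by
  refine (h.irreducible W (fun x hx => ?_) (fun x hx => ?_) hz).resolve_left hW
  · have hmem := W.add_mem (hraise x hx) (hlower x hx)
    rwa [← LinearMap.add_apply, raising_add_lowering, LinearMap.smul_apply,
      W.smul_mem_iff two_ne_zero] at hmem
  · have hmem := W.sub_mem (hraise x hx) (hlower x hx)
    rwa [← LinearMap.sub_apply, raising_sub_lowering, LinearMap.smul_apply,
      W.smul_mem_iff (by simp)] at hmem

theorem isSl2Triple (h : IsIrreducibleSpin Jx Jy Jz) (hn : 1 < finrank ℂ V) :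
    IsSl2Triple (L := End ℂ V) ((2 : ℂ) • Jz) (raising Jx Jy) (lowering Jx Jy) where
  h_ne_zero := smul_ne_zero two_ne_zero (h.z_ne_zero hn)
  lie_e_f := by
    have hz : Jz = -(Complex.I • (Jx * Jy - Jy * Jx)) := by
      rw [h.comm_xy, smul_smul, Complex.I_mul_I, neg_one_smul, neg_neg]
    rw [Ring.lie_def, raising, lowering, hz]
    simp only [add_mul, mul_add, sub_mul, mul_sub, smul_mul_assoc, mul_smul_comm]
    module
  lie_h_e_nsmul := by
    have hcomm : ⁅((2 : ℂ) • Jz : End ℂ V), raising Jx Jy⁆ = (2 : ℂ) •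
        ((Jz * Jx - Jx * Jz) - Complex.I • (Jy * Jz - Jz * Jy)) := by
      rw [Ring.lie_def, raising]
      simp only [add_mul, mul_add, smul_mul_assoc, mul_smul_comm]
      module
    rw [hcomm, h.comm_zx, h.comm_yz, smul_smul, Complex.I_mul_I, raising]
    module
  lie_h_f_nsmul := by
    have hcomm : ⁅((2 : ℂ) • Jz : End ℂ V), lowering Jx Jy⁆ = (2 : ℂ) •
        ((Jz * Jx - Jx * Jz) + Complex.I • (Jy * Jz - Jz * Jy)) := by
      rw [Ring.lie_def, lowering]
      simp only [sub_mul, mul_sub, smul_mul_assoc, mul_smul_comm]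
      module
    rw [hcomm, h.comm_zx, h.comm_yz, smul_smul, Complex.I_mul_I, lowering]
    module

section PrimitiveVector

variable {t : IsSl2Triple (L := End ℂ V) ((2 : ℂ) • Jz) (raising Jx Jy) (lowering Jx Jy)} {u : V}
  {μ : ℂ} (hu : t.HasPrimitiveVectorWith u μ)

include hu

theorem z_pow_lowering (i : ℕ) :
    Jz ((lowering Jx Jy ^ i) u) = (μ / 2 - i) • (lowering Jx Jy ^ i) u := by
  have h2 := hu.lie_h_pow_toEnd_f i
  rw [LieModule.toEnd_module_end] at h2
  have h3 : (2 : ℂ) • Jz ((lowering Jx Jy ^ i) u) =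
    (μ - 2 * i) • (lowering Jx Jy ^ i) u := h2
  rw [← smul_right_inj (two_ne_zero' ℂ), h3, smul_smul]
  ring_nf

theorem raising_pow_succ_lowering (i : ℕ) :
    raising Jx Jy ((lowering Jx Jy ^ (i + 1)) u) =
      ((i + 1) * (μ - i)) • (lowering Jx Jy ^ i) u := by
  have h2 := hu.lie_e_pow_succ_toEnd_f i
  rw [LieModule.toEnd_module_end] at h2
  exact h2

variable (h : IsIrreducibleSpin Jx Jy Jz)

include h

theorem inner_pow_lowering_eq_zero {i k : ℕ} (hik : i ≠ k) :
    ⟪(lowering Jx Jy ^ i) u, (lowering Jx Jy ^ k) u⟫_ℂ = 0 := by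
  have hne : μ / 2 - i ≠ μ / 2 - k := fun e => hik (by exact_mod_cast sub_right_inj.mp e)
  exact h.symm_z.orthogonalFamily_eigenspaces hne
    ⟨_, End.mem_eigenspace_iff.mpr (z_pow_lowering hu i)⟩
    ⟨_, End.mem_eigenspace_iff.mpr (z_pow_lowering hu k)⟩

theorem span_pow_lowering_eq_top :
    Submodule.span ℂ (Set.range fun i : ℕ => (lowering Jx Jy ^ i) u) = ⊤ := by
  set W := Submodule.span ℂ (Set.range fun i : ℕ => (lowering Jx Jy ^ i) u)
  have hmem : ∀ i, (lowering Jx Jy ^ i) u ∈ W := fun i => Submodule.subset_span ⟨i, rfl⟩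
  have invariant_of : ∀ T : V →ₗ[ℂ] V, (∀ i, T ((lowering Jx Jy ^ i) u) ∈ W) →
      ∀ x ∈ W, T x ∈ W := fun T hT x hx =>
    (Submodule.span_le.mpr (by rintro _ ⟨i, rfl⟩; exact hT i) : W ≤ W.comap T) hx
  refine h.eq_top_of_invariant ?_ (invariant_of _ fun i => ?_) (invariant_of _ fun i => ?_)
    (invariant_of _ fun i => ?_)
  · exact (Submodule.ne_bot_iff W).mpr ⟨u, hmem 0, hu.ne_zero⟩
  · cases i with
    | zero =>
      have hzero : raising Jx Jy u = 0 := hu.lie_e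
      simp [hzero]
    | succ i =>
      rw [raising_pow_succ_lowering hu]
      exact W.smul_mem _ (hmem i)
  · rw [← End.mul_apply, ← pow_succ']
    exact hmem (i + 1)
  · rw [z_pow_lowering hu]
    exact W.smul_mem _ (hmem i)

variable [FiniteDimensional ℂ V]

theorem weight_eq_finrank_sub_one : μ = finrank ℂ V - 1 := by
  obtain ⟨k, hk⟩ := hu.exists_nat
  have hzero : (lowering Jx Jy ^ (k + 1)) u = 0 := by
    simpa [LieModule.toEnd_module_end] using hu.pow_toEnd_f_eq_zero_of_eq_nat hk
  have hne : ∀ i : Fin (k + 1), (lowering Jx Jy ^ (i : ℕ)) u ≠ 0 := fun i => by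
    simpa [LieModule.toEnd_module_end] using
      hu.pow_toEnd_f_ne_zero_of_eq_nat hk (Nat.lt_succ_iff.mp i.2)
  have hspan : Submodule.span ℂ (Set.range fun i : Fin (k + 1) => (lowering Jx Jy ^ (i : ℕ)) u) =
      ⊤ := by
    rw [eq_top_iff, ← h.span_pow_lowering_eq_top hu, Submodule.span_le]
    rintro _ ⟨i, rfl⟩
    rcases lt_or_ge i (k + 1) with hi | hi
    · exact Submodule.subset_span ⟨⟨i, hi⟩, rfl⟩
    · obtain ⟨m, rfl⟩ := Nat.exists_eq_add_of_le' hi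
      simp [pow_add (lowering Jx Jy) m, hzero]
  have hli : LinearIndependent ℂ fun i : Fin (k + 1) => (lowering Jx Jy ^ (i : ℕ)) u :=
    linearIndependent_of_ne_zero_of_inner_eq_zero hne fun i l hil =>
      h.inner_pow_lowering_eq_zero hu fun e => hil (Fin.ext e)
  have hdim : finrank ℂ V = k + 1 := by
    rw [← finrank_top ℂ V, ← hspan, finrank_span_eq_card hli, Fintype.card_fin]
  rw [hk, hdim]
  push_cast
  ring

theorem norm_pow_succ_lowering (i : ℕ) :
    ‖(lowering Jx Jy ^ (i + 1)) u‖ ^ 2 =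
      ((i + 1) * (finrank ℂ V - 1 - i)) * ‖(lowering Jx Jy ^ i) u‖ ^ 2 := by
  have hadj : ⟪(lowering Jx Jy ^ (i + 1)) u, (lowering Jx Jy ^ (i + 1)) u⟫_ℂ =
      ⟪(lowering Jx Jy ^ i) u, raising Jx Jy ((lowering Jx Jy ^ (i + 1)) u)⟫_ℂ := by
    rw [← h.inner_lowering_left, ← End.mul_apply, ← pow_succ']
  rw [raising_pow_succ_lowering hu, inner_smul_right, inner_self_eq_norm_sq_to_K,
    inner_self_eq_norm_sq_to_K, h.weight_eq_finrank_sub_one hu] at hadj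
  refine Complex.ofReal_injective ?_
  push_cast
  exact hadj

theorem norm_pow_succ_lowering_eq_ladderCoeff (i : ℕ) :
    ‖(lowering Jx Jy ^ (i + 1)) u‖ =
      2 * ladderCoeff (finrank ℂ V) i * ‖(lowering Jx Jy ^ i) u‖ := by
  rw [← Real.sqrt_sq (norm_nonneg ((lowering Jx Jy ^ (i + 1)) u)), h.norm_pow_succ_lowering hu,
    Real.sqrt_mul' _ (sq_nonneg _), Real.sqrt_sq (norm_nonneg _), ladderCoeff]
  ring

theorem pow_lowering_ne_zero {i : ℕ} (hi : i < finrank ℂ V) : (lowering Jx Jy ^ i) u ≠ 0 := by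
  induction i with
  | zero => exact hu.ne_zero
  | succ i ih =>
    have hpos : (0 : ℝ) < finrank ℂ V - 1 - i := by
      have : ((i + 1 : ℕ) : ℝ) < finrank ℂ V := by exact_mod_cast hi
      push_cast at this
      linarith
    have hne := ih (Nat.lt_of_succ_lt hi)
    have hsq : 0 < ‖(lowering Jx Jy ^ (i + 1)) u‖ ^ 2 := by
      rw [h.norm_pow_succ_lowering hu]
      positivity
    exact norm_ne_zero_iff.mp (pow_ne_zero_iff two_ne_zero |>.mp hsq.ne')

theorem lowering_normalized (i : ℕ) :
    lowering Jx Jy ((‖(lowering Jx Jy ^ i) u‖⁻¹ : ℂ) • (lowering Jx Jy ^ i) u) =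
      (2 * ladderCoeff (finrank ℂ V) i : ℂ) •
        ((‖(lowering Jx Jy ^ (i + 1)) u‖⁻¹ : ℂ) • (lowering Jx Jy ^ (i + 1)) u) := by
  rw [map_smul, ← End.mul_apply, ← pow_succ', smul_smul]
  have hnorm := h.norm_pow_succ_lowering_eq_ladderCoeff hu i
  rcases eq_or_ne ((lowering Jx Jy ^ (i + 1)) u) 0 with hzero | hne
  · simp [hzero]
  · have hc : (ladderCoeff (finrank ℂ V) i : ℂ) ≠ 0 := fun hc => hne <| norm_eq_zero.mp <| by
      simp [hnorm, Complex.ofReal_eq_zero.mp hc]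
    congr 1
    rw [hnorm]
    push_cast
    rw [mul_inv, mul_inv_cancel_left₀ (mul_ne_zero two_ne_zero hc)]

theorem raising_normalized (i : ℕ) :
    raising Jx Jy ((‖(lowering Jx Jy ^ (i + 1)) u‖⁻¹ : ℂ) • (lowering Jx Jy ^ (i + 1)) u) =
      (2 * ladderCoeff (finrank ℂ V) i : ℂ) •
        ((‖(lowering Jx Jy ^ i) u‖⁻¹ : ℂ) • (lowering Jx Jy ^ i) u) := by
  rw [map_smul, raising_pow_succ_lowering hu, h.weight_eq_finrank_sub_one hu,
    h.norm_pow_succ_lowering_eq_ladderCoeff hu, smul_smul, smul_smul]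
  rcases eq_or_ne ((lowering Jx Jy ^ i) u) 0 with hzero | hne
  · simp [hzero]
  · have hnonneg : (0 : ℝ) ≤ (i + 1) * (finrank ℂ V - 1 - i) :=
      nonneg_of_mul_nonneg_left ((h.norm_pow_succ_lowering hu i).symm ▸ sq_nonneg _)
        (by positivity : 0 < ‖(lowering Jx Jy ^ i) u‖ ^ 2)
    have hsq : ((i + 1) * (finrank ℂ V - 1 - i) : ℂ) =
        (2 * ladderCoeff (finrank ℂ V) i : ℂ) ^ 2 := by
      have hsqrt := Real.sq_sqrt hnonneg
      rw [ladderCoeff]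
      push_cast
      rw [mul_div_cancel₀ _ (two_ne_zero' ℂ)]
      exact_mod_cast hsqrt.symm
    have hu0 : (‖(lowering Jx Jy ^ i) u‖ : ℂ) ≠ 0 := by simpa using hne
    congr 1
    rw [hsq]
    push_cast
    rcases eq_or_ne (ladderCoeff (finrank ℂ V) i : ℂ) 0 with hc | hc
    · simp [hc]
    · field_simp

end PrimitiveVector

theorem exists_isWeightBasis [FiniteDimensional ℂ V] (h : IsIrreducibleSpin Jx Jy Jz)
    (hn : 1 < finrank ℂ V) : ∃ v : ℕ → V, IsWeightBasis Jx Jz v := by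
  have := h.nontrivial
  obtain ⟨μ, u, -, hu⟩ := (h.isSl2Triple hn).exists_hasPrimitiveVectorWith (R := ℂ) (M := V)
  refine ⟨fun i => (‖(lowering Jx Jy ^ i) u‖⁻¹ : ℂ) • (lowering Jx Jy ^ i) u, ⟨fun i => ?_,
    fun i k hik => ?_⟩, fun i => ?_, fun i => ?_⟩
  · exact norm_smul_inv_norm (h.pow_lowering_ne_zero hu i.2)
  · simp only [inner_smul_left, inner_smul_right,
      h.inner_pow_lowering_eq_zero hu (Fin.val_ne_of_ne hik), mul_zero]
  · rw [map_smul, z_pow_lowering hu, h.weight_eq_finrank_sub_one hu, smul_comm, spinNumber]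
    push_cast
    rfl
  · rw [← smul_right_inj (two_ne_zero' ℂ), ← LinearMap.smul_apply, ← raising_add_lowering Jx Jy,
      LinearMap.add_apply, h.raising_normalized hu, h.lowering_normalized hu]
    module

end IsIrreducibleSpin

theorem IsWeightBasis.span_eq_top {V : Type*} [NormedAddCommGroup V] [InnerProductSpace ℂ V]
    [FiniteDimensional ℂ V] {Jx Jz : V →ₗ[ℂ] V} {v : ℕ → V} (hv : IsWeightBasis Jx Jz v) :
    Submodule.span ℂ (Set.range fun i : Fin (finrank ℂ V) => v i) = ⊤ :=
  hv.orthonormal.linearIndependent.span_eq_top_of_card_eq_finrank' (Fintype.card_fin _)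

theorem IsIrreducibleSpin.abs_le_of_hasEigenvalue {V : Type*} [NormedAddCommGroup V]
    [InnerProductSpace ℂ V] [FiniteDimensional ℂ V] {Jx Jy Jz : V →ₗ[ℂ] V}
    (h : IsIrreducibleSpin Jx Jy Jz) (hn : 1 < finrank ℂ V) {μ : ℝ}
    (hμ : End.HasEigenvalue Jz (μ : ℂ)) : |μ| ≤ spinNumber (finrank ℂ V) := by
  obtain ⟨v, hv⟩ := h.exists_isWeightBasis hn
  obtain ⟨w, hw⟩ := hμ.exists_hasEigenvector
  obtain ⟨i, hi⟩ : ∃ i : Fin (finrank ℂ V), μ = spinNumber (finrank ℂ V) - i := by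
    by_contra! hne
    refine hw.2 ((inner_self_eq_zero (𝕜 := ℂ)).mp ?_)
    have hle : Submodule.span ℂ (Set.range fun i : Fin (finrank ℂ V) => v i) ≤ (ℂ ∙ w)ᗮ := by
      refine Submodule.span_le.mpr ?_
      rintro _ ⟨i, rfl⟩
      exact Submodule.mem_orthogonal_singleton_iff_inner_right.mpr
        (h.symm_z.orthogonalFamily_eigenspaces (Complex.ofReal_injective.ne (hne i)) ⟨w, hw.1⟩
          ⟨v i, End.mem_eigenspace_iff.mpr (hv.apply_z i)⟩)
    rw [hv.span_eq_top] at hle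
    exact Submodule.mem_orthogonal_singleton_iff_inner_right.mp (hle Submodule.mem_top)
  have hcast : ((i + 1 : ℕ) : ℝ) ≤ finrank ℂ V := by exact_mod_cast i.2
  push_cast at hcast
  rw [hi, spinNumber, abs_le]
  constructor <;> linarith [(i : ℕ).cast_nonneg (α := ℝ)]

/-! ### Fourier coefficients of functions of `cos θ` -/

section CosFourierCoeff

open MeasureTheory Real

/-- The matrix elements in the Fourier basis `k ↦ exp (i k θ)` of multiplication by `f (cos θ)` on
`L²` of the circle: the entry at `(k, m)` is `cosFourierCoeff f (k - m)`. -/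
noncomputable def cosFourierCoeff (f : ℝ → ℝ) (d : ℤ) : ℝ :=
  π⁻¹ * ∫ θ in (0 : ℝ)..π, f (cos θ) * cos (d * θ)

theorem integral_cos_int_mul (d : ℤ) :
    ∫ θ in (0 : ℝ)..π, cos (d * θ) = if d = 0 then π else 0 := by
  split_ifs with h
  · simp [h]
  · rw [intervalIntegral.integral_comp_mul_left cos (Int.cast_ne_zero.mpr h), integral_cos]
    simp [sin_int_mul_pi]

theorem cosFourierCoeff_const (c : ℝ) (d : ℤ) :
    cosFourierCoeff (fun _ => c) d = if d = 0 then c else 0 := by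
  simp only [cosFourierCoeff, intervalIntegral.integral_const_mul, integral_cos_int_mul]
  split_ifs
  · field_simp
  · simp

theorem intervalIntegrable_mul_cos {f : ℝ → ℝ} {x y : ℝ} (hf : IntervalIntegrable f volume x y)
    (d : ℤ) : IntervalIntegrable (fun θ => f θ * cos (d * θ)) volume x y :=
  hf.mul_continuousOn (by fun_prop)

theorem cosFourierCoeff_add {f g : ℝ → ℝ}
    (hf : IntervalIntegrable (fun θ => f (cos θ)) volume 0 π)
    (hg : IntervalIntegrable (fun θ => g (cos θ)) volume 0 π) (d : ℤ) :
    cosFourierCoeff (fun x => f x + g x) d = cosFourierCoeff f d + cosFourierCoeff g d := by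
  simp only [cosFourierCoeff, add_mul]
  rw [intervalIntegral.integral_add (intervalIntegrable_mul_cos hf d)
    (intervalIntegrable_mul_cos hg d), mul_add]

theorem cosFourierCoeff_id_mul {f : ℝ → ℝ}
    (hf : IntervalIntegrable (fun θ => f (cos θ)) volume 0 π) (d : ℤ) :
    cosFourierCoeff (fun x => x * f x) d =
      (cosFourierCoeff f (d - 1) + cosFourierCoeff f (d + 1)) / 2 := by
  have hprod : ∀ θ : ℝ, cos θ * f (cos θ) * cos (d * θ) =
      (f (cos θ) * cos ((d - 1 : ℤ) * θ) + f (cos θ) * cos ((d + 1 : ℤ) * θ)) / 2 := by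
    intro θ
    push_cast
    rw [sub_mul, add_mul, one_mul, cos_sub, cos_add]
    ring
  simp only [cosFourierCoeff, hprod]
  rw [intervalIntegral.integral_div, intervalIntegral.integral_add
    (intervalIntegrable_mul_cos hf _) (intervalIntegrable_mul_cos hf _)]
  ring

theorem intervalIntegrable_eval_cos (p : ℝ[X]) (x y : ℝ) :
    IntervalIntegrable (fun θ => p.eval (cos θ)) volume x y :=
  (p.continuous.comp continuous_cos).intervalIntegrable _ _

theorem cosFourierCoeff_eval_add (p q : ℝ[X]) (d : ℤ) :
    cosFourierCoeff (fun x => (p + q).eval x) d =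
      cosFourierCoeff (fun x => p.eval x) d + cosFourierCoeff (fun x => q.eval x) d := by
  simp only [eval_add]
  exact cosFourierCoeff_add (intervalIntegrable_eval_cos p _ _)
    (intervalIntegrable_eval_cos q _ _) d

theorem cosFourierCoeff_eval_mul_X (p : ℝ[X]) (d : ℤ) :
    cosFourierCoeff (fun x => (p * X).eval x) d =
      (cosFourierCoeff (fun x => p.eval x) (d - 1) +
        cosFourierCoeff (fun x => p.eval x) (d + 1)) / 2 := by
  simp only [eval_mul, eval_X, mul_comm _ (_ : ℝ)]
  exact cosFourierCoeff_id_mul (intervalIntegrable_eval_cos p _ _) d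

theorem abs_cosFourierCoeff_sub_le {f g q : ℝ → ℝ}
    (hf : IntervalIntegrable (fun θ => f (cos θ)) volume 0 π)
    (hg : IntervalIntegrable (fun θ => g (cos θ)) volume 0 π)
    (hq : IntervalIntegrable (fun θ => q (cos θ)) volume 0 π)
    (hfg : ∀ x ∈ Set.Icc (-1 : ℝ) 1, |f x - g x| ≤ q x) (d : ℤ) :
    |cosFourierCoeff f d - cosFourierCoeff g d| ≤ cosFourierCoeff q 0 := by
  simp only [cosFourierCoeff, Int.cast_zero, zero_mul, cos_zero, mul_one]
  rw [← mul_sub, ← intervalIntegral.integral_sub (intervalIntegrable_mul_cos hf d)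
    (intervalIntegrable_mul_cos hg d), abs_mul, abs_of_pos (inv_pos.mpr pi_pos)]
  refine mul_le_mul_of_nonneg_left ?_ (inv_pos.mpr pi_pos).le
  rw [← norm_eq_abs]
  refine intervalIntegral.norm_integral_le_of_norm_le (g := fun θ => q (cos θ)) pi_pos.le
    (Eventually.of_forall fun θ _ => ?_) hq
  calc ‖f (cos θ) * cos (d * θ) - g (cos θ) * cos (d * θ)‖
      = |f (cos θ) - g (cos θ)| * |cos (d * θ)| := by rw [← sub_mul, norm_eq_abs, abs_mul]
    _ ≤ |f (cos θ) - g (cos θ)| := mul_le_of_le_one_right (abs_nonneg _) (abs_cos_le_one _)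
    _ ≤ q (cos θ) := hfg _ ⟨neg_one_le_cos θ, cos_le_one θ⟩

theorem intervalIntegrable_indicator_Ioi_cos (a x y : ℝ) :
    IntervalIntegrable (fun θ => (Set.Ioi a).indicator (1 : ℝ → ℝ) (cos θ)) volume x y := by
  have hmeas : Measurable fun θ => (Set.Ioi a).indicator (1 : ℝ → ℝ) (cos θ) :=
    (measurable_one.indicator measurableSet_Ioi).comp measurable_cos
  refine (intervalIntegrable_const (c := (1 : ℝ))).mono_fun hmeas.aestronglyMeasurable
    (Eventually.of_forall fun θ => ?_)
  exact (norm_indicator_le_norm_self _ _).trans (by simp)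

theorem indicator_Ioi_cos_ae_eq {a : ℝ} (ha : a ∈ Set.Icc (-1 : ℝ) 1) :
    ∀ᵐ θ : ℝ, θ ∈ Set.Icc 0 π → (Set.Ioi a).indicator (1 : ℝ → ℝ) (cos θ) =
      (Set.Iic (arccos a)).indicator 1 θ := by
  filter_upwards [Measure.ae_ne volume (arccos a)] with θ hne hθ
  have hiff : a < cos θ ↔ θ ≤ arccos a := by
    rw [hne.le_iff_lt]
    conv_lhs => rw [← cos_arccos ha.1 ha.2]
    exact strictAntiOn_cos.lt_iff_gt ⟨arccos_nonneg a, arccos_le_pi a⟩ hθ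
  simp only [Set.indicator_apply, Set.mem_Ioi, Set.mem_Iic, hiff, Pi.one_apply]

theorem cosFourierCoeff_indicator_Ioi {a : ℝ} (ha : a ∈ Set.Icc (-1 : ℝ) 1) {d : ℤ} (hd : d ≠ 0) :
    cosFourierCoeff ((Set.Ioi a).indicator 1) d = sin (d * arccos a) / (π * d) := by
  have htrunc : ∫ θ in (0 : ℝ)..π, (Set.Ioi a).indicator (1 : ℝ → ℝ) (cos θ) * cos (d * θ) =
      ∫ θ in (0 : ℝ)..arccos a, cos (d * θ) := by
    rw [← intervalIntegral.integral_indicator ⟨arccos_nonneg a, arccos_le_pi a⟩]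
    refine intervalIntegral.integral_congr_ae ?_
    filter_upwards [indicator_Ioi_cos_ae_eq ha] with θ hind hθ
    rw [Set.uIoc_of_le pi_pos.le] at hθ
    rw [hind ⟨hθ.1.le, hθ.2⟩]
    by_cases hle : θ ≤ arccos a <;> simp [hle]
  rw [cosFourierCoeff, htrunc,
    intervalIntegral.integral_comp_mul_left cos (Int.cast_ne_zero.mpr hd), integral_cos]
  simp only [mul_zero, sin_zero, sub_zero, smul_eq_mul]
  field_simp

end CosFourierCoeff

/-! ### Polynomial approximation of step functions -/

section PolynomialSandwich

open MeasureTheory Real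

/-- The truncation of `y` to `[0, 1]`, used for continuous approximations to step functions. -/
noncomputable def ramp (y : ℝ) : ℝ := max 0 (min 1 y)

theorem continuous_ramp : Continuous ramp := by unfold ramp; fun_prop

theorem ramp_nonneg (y : ℝ) : 0 ≤ ramp y := le_max_left _ _

theorem ramp_le_one (y : ℝ) : ramp y ≤ 1 := max_le zero_le_one (min_le_left _ _)

theorem ramp_of_nonpos {y : ℝ} (hy : y ≤ 0) : ramp y = 0 :=
  max_eq_left ((min_le_right _ _).trans hy)

theorem ramp_of_one_le {y : ℝ} (hy : 1 ≤ y) : ramp y = 1 := by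
  rw [ramp, min_eq_left hy, max_eq_right zero_le_one]

theorem abs_indicator_Ioi_sub_ramp_le (a x : ℝ) {m : ℝ} (hm : 0 ≤ m) :
    |(Set.Ioi a).indicator 1 x - ramp (m * (x - a))| ≤
      ramp (m * (x - a) + 1) - ramp (m * (x - a)) := by
  rcases lt_or_ge a x with hx | hx
  · have hpos : 0 ≤ m * (x - a) := mul_nonneg hm (sub_nonneg.mpr hx.le)
    rw [Set.indicator_of_mem (Set.mem_Ioi.mpr hx), Pi.one_apply, ramp_of_one_le (y := _ + 1)
      (by linarith), abs_of_nonneg (sub_nonneg.mpr (ramp_le_one _))]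
  · have hneg : m * (x - a) ≤ 0 := mul_nonpos_of_nonneg_of_nonpos hm (sub_nonpos.mpr hx)
    rw [Set.indicator_of_notMem (Set.notMem_Ioi.mpr hx), ramp_of_nonpos hneg, sub_zero, abs_zero,
      sub_zero]
    exact ramp_nonneg _

theorem eventually_ramp_sub_ramp_eq_zero {a x : ℝ} (hx : x ≠ a) :
    ∀ᶠ m : ℕ in atTop, ramp (m * (x - a) + 1) - ramp (m * (x - a)) = 0 := by
  obtain ⟨m₀, hm₀⟩ := exists_nat_gt |x - a|⁻¹
  filter_upwards [eventually_ge_atTop m₀] with m hm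
  have hpos : 0 < |x - a| := abs_pos.mpr (sub_ne_zero.mpr hx)
  have hlarge : 1 ≤ m * |x - a| := by
    rw [← inv_le_iff_one_le_mul₀ hpos]
    exact hm₀.le.trans (by exact_mod_cast hm)
  rcases abs_cases (x - a) with ⟨habs, -⟩ | ⟨habs, -⟩ <;> rw [habs] at hlarge
  · rw [ramp_of_one_le hlarge, ramp_of_one_le (by linarith), sub_self]
  · rw [ramp_of_nonpos (by linarith), ramp_of_nonpos (by linarith), sub_self]

theorem tendsto_cosFourierCoeff_ramp_sub_ramp (a : ℝ) :
    Tendsto (fun m : ℕ => cosFourierCoeff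
      (fun x => ramp (m * (x - a) + 1) - ramp (m * (x - a))) 0) atTop (𝓝 0) := by
  have hlim : Tendsto (fun m : ℕ => ∫ θ in (0 : ℝ)..π,
      (ramp (m * (cos θ - a) + 1) - ramp (m * (cos θ - a)))) atTop
      (𝓝 (∫ _ in (0 : ℝ)..π, (0 : ℝ))) := by
    refine intervalIntegral.tendsto_integral_filter_of_dominated_convergence (fun _ => 1)
      (Eventually.of_forall fun m => ?_)
      (Eventually.of_forall fun m => Eventually.of_forall fun θ _ => ?_)
      intervalIntegrable_const ?_
    · exact ((continuous_ramp.comp (by fun_prop)).sub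
        (continuous_ramp.comp (by fun_prop))).aestronglyMeasurable
    · exact abs_sub_le_of_nonneg_of_le (ramp_nonneg _) (ramp_le_one _) (ramp_nonneg _)
        (ramp_le_one _)
    · filter_upwards [Measure.ae_ne volume (arccos a)] with θ hne hθ
      rw [Set.uIoc_of_le pi_pos.le] at hθ
      have hcos : cos θ ≠ a := fun h => hne (by rw [← h, arccos_cos hθ.1.le hθ.2])
      exact tendsto_const_nhds.congr' ((eventually_ramp_sub_ramp_eq_zero hcos).mono
        fun m hm => hm.symm)
  simpa [cosFourierCoeff] using hlim.const_mul π⁻¹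

theorem exists_polynomial_sandwich {f g t : ℝ → ℝ} (hf : Continuous f) (ht : Continuous t)
    (hgf : ∀ x, |g x - f x| ≤ t x) {ε : ℝ} (hε : 0 < ε) :
    ∃ p q : ℝ[X], (∀ x ∈ Set.Icc (-1 : ℝ) 1, |g x - p.eval x| ≤ q.eval x) ∧
      cosFourierCoeff (fun x => q.eval x) 0 ≤ cosFourierCoeff t 0 + ε := by
  have hη : 0 < ε / 3 := by positivity
  obtain ⟨p, hp⟩ := exists_polynomial_near_of_continuousOn (-1) 1 f hf.continuousOn _ hη
  obtain ⟨q, hq⟩ := exists_polynomial_near_of_continuousOn (-1) 1 (fun x => t x + 2 * (ε / 3))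
    (ht.add continuous_const).continuousOn _ hη
  refine ⟨p, q, fun x hx => ?_, ?_⟩
  · have hpx := abs_lt.mp (hp x hx)
    have hqx := abs_lt.mp (hq x hx)
    have hgx := abs_le.mp (hgf x)
    exact abs_le.mpr ⟨by linarith, by linarith⟩
  · have hint : ∀ {u : ℝ → ℝ}, Continuous u →
        IntervalIntegrable (fun θ => u (cos θ)) volume 0 π := fun hu =>
      (hu.comp continuous_cos).intervalIntegrable _ _
    have hdiff := abs_cosFourierCoeff_sub_le (hint q.continuous)
      (hint (by fun_prop : Continuous fun x => t x + 2 * (ε / 3)))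
      (hint (continuous_const (y := ε / 3))) (fun x hx => (hq x hx).le) 0
    rw [cosFourierCoeff_add (hint ht) (hint continuous_const)] at hdiff
    simp only [cosFourierCoeff_const, if_pos] at hdiff
    linarith [(abs_le.mp hdiff).2]

theorem exists_polynomial_sandwich_indicator_Ioi (a : ℝ) {ε : ℝ} (hε : 0 < ε) :
    ∃ p q : ℝ[X],
      (∀ x ∈ Set.Icc (-1 : ℝ) 1, |(Set.Ioi a).indicator 1 x - p.eval x| ≤ q.eval x) ∧
      cosFourierCoeff (fun x => q.eval x) 0 ≤ ε := by
  obtain ⟨m, hm⟩ := ((tendsto_cosFourierCoeff_ramp_sub_ramp a).eventually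
    (gt_mem_nhds (half_pos hε))).exists
  have hramp : Continuous fun x => ramp (m * (x - a)) := continuous_ramp.comp (by fun_prop)
  have hramp' : Continuous fun x => ramp (m * (x - a) + 1) := continuous_ramp.comp (by fun_prop)
  obtain ⟨p, q, hpq, hq⟩ := exists_polynomial_sandwich hramp
    (t := fun x => ramp (m * (x - a) + 1) - ramp (m * (x - a))) (hramp'.sub hramp)
    (fun x => abs_indicator_Ioi_sub_ramp_le a x (Nat.cast_nonneg m)) (half_pos hε)
  exact ⟨p, q, hpq, hq.trans (by linarith)⟩

end PolynomialSandwich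

/-! ### Operators that are asymptotically a free Jacobi matrix -/

section FreeJacobi

variable {ι : Type*} {l : Filter ι} {V : ι → Type*} [∀ i, NormedAddCommGroup (V i)]
  [∀ i, InnerProductSpace ℂ (V i)] {T : ∀ i, V i →ₗ[ℂ] V i} {e : ∀ i, ℤ → V i}

/-- Along `l`, the vectors `e i k` become orthonormal and `T i` acts on them as a Jacobi matrix
whose off-diagonal entries tend to `1 / 2`. In the limit this is multiplication by `cos θ` in the
Fourier basis. No uniformity in `k` is required, so that `e i` may be truncated to finitely many
nonzero vectors. -/
structure TendstoFreeJacobi (l : Filter ι) (T : ∀ i, V i →ₗ[ℂ] V i) (e : ∀ i, ℤ → V i) :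
    Prop where
  inner_eq : ∀ k m, ∀ᶠ i in l, ⟪e i k, e i m⟫_ℂ = if k = m then 1 else 0
  apply_eq : ∃ c : ι → ℤ → ℝ, (∀ k, Tendsto (c · k) l (𝓝 (1 / 2))) ∧
    ∀ k, ∀ᶠ i in l, T i (e i k) = (c i (k - 1) : ℂ) • e i (k - 1) + (c i k : ℂ) • e i (k + 1)

namespace TendstoFreeJacobi

theorem eventually_orthonormal (h : TendstoFreeJacobi l T e) {κ : Type*} [Finite κ] {j : κ → ℤ}
    (hj : Function.Injective j) : ∀ᶠ i in l, Orthonormal ℂ fun k => e i (j k) := by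
  classical
  simp only [orthonormal_iff_ite, eventually_all]
  simpa only [hj.eq_iff] using fun k m => h.inner_eq (j k) (j m)

theorem tendsto_inner_aeval (h : TendstoFreeJacobi l T e) (p : ℝ[X]) (k m : ℤ) :
    Tendsto (fun i => ⟪e i k, aeval (T i) p (e i m)⟫_ℂ) l
      (𝓝 (cosFourierCoeff (fun x => p.eval x) (k - m) : ℝ)) := by
  induction p using Polynomial.induction_on generalizing m with
  | C a =>
    simp only [eval_C, cosFourierCoeff_const, sub_eq_zero]
    refine tendsto_const_nhds.congr' ((h.inner_eq k m).mono fun i hi => ?_)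
    beta_reduce
    rw [aeval_C, Module.algebraMap_end_apply, ← Complex.coe_smul, inner_smul_right, hi]
    split_ifs <;> simp
  | add p q hp hq =>
    simp only [map_add, LinearMap.add_apply, inner_add_right]
    rw [cosFourierCoeff_eval_add, Complex.ofReal_add]
    exact (hp m).add (hq m)
  | monomial r a ih =>
    rw [pow_succ, ← mul_assoc, cosFourierCoeff_eval_mul_X]
    set p : ℝ[X] := C a * X ^ r
    obtain ⟨c, hc, hT⟩ := h.apply_eq
    have hlim := (((Complex.continuous_ofReal.tendsto _).comp (hc (m - 1))).mul (ih (m - 1))).add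
      (((Complex.continuous_ofReal.tendsto _).comp (hc m)).mul (ih (m + 1)))
    have hval : ((1 / 2 : ℝ) : ℂ) * (cosFourierCoeff (fun x => p.eval x) (k - (m - 1)) : ℝ) +
        ((1 / 2 : ℝ) : ℂ) * (cosFourierCoeff (fun x => p.eval x) (k - (m + 1)) : ℝ) =
        (((cosFourierCoeff (fun x => p.eval x) (k - m - 1) +
          cosFourierCoeff (fun x => p.eval x) (k - m + 1)) / 2 : ℝ) : ℂ) := by
      rw [← sub_add, ← sub_sub]
      push_cast
      ring
    rw [hval] at hlim
    refine hlim.congr' ((hT m).mono fun i hi => ?_)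
    have happly : aeval (T i) (p * X) (e i m) = aeval (T i) p (T i (e i m)) := by
      rw [map_mul, aeval_X, Module.End.mul_apply]
    simp only [happly, hi, map_add, map_smul, inner_add_right, inner_smul_right,
      Function.comp_apply]

/-- The step function is trapped between polynomials whose difference is small in `L¹` of the circle
after substituting `cos θ`; the errors are controlled by diagonal matrix elements of this
difference. -/
theorem tendsto_inner_spectralProjection_Ioi [∀ i, FiniteDimensional ℂ (V i)]
    (h : TendstoFreeJacobi l T e) (hT : ∀ i, (T i).IsSymmetric)
    (hspec : ∀ᶠ i in l, ∀ μ : ℝ, End.HasEigenvalue (T i) (μ : ℂ) → μ ∈ Set.Icc (-1 : ℝ) 1)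
    (a : ℝ) (k m : ℤ) :
    Tendsto (fun i => ⟪e i k, spectralProjection (T i) (Set.Ioi a) (e i m)⟫_ℂ) l
      (𝓝 (cosFourierCoeff ((Set.Ioi a).indicator 1) (k - m) : ℝ)) := by
  rw [Metric.tendsto_nhds]
  intro ε hε
  obtain ⟨p, q, hpq, hq⟩ := exists_polynomial_sandwich_indicator_Ioi a
    (by positivity : 0 < ε / 8)
  have hlim : ∀ d, |cosFourierCoeff ((Set.Ioi a).indicator 1) d -
      cosFourierCoeff (fun x => p.eval x) d| ≤ cosFourierCoeff (fun x => q.eval x) 0 :=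
    abs_cosFourierCoeff_sub_le (intervalIntegrable_indicator_Ioi_cos a _ _)
      (intervalIntegrable_eval_cos p _ _) (intervalIntegrable_eval_cos q _ _) hpq
  have hq_diag : ∀ k, ∀ᶠ i in l, ‖⟪e i k, aeval (T i) q (e i k)⟫_ℂ‖ < ε / 4 := by
    intro k
    have hk := (h.tendsto_inner_aeval q k k).norm
    rw [sub_self, Complex.norm_real, Real.norm_eq_abs,
      abs_of_nonneg ((abs_nonneg _).trans (hlim 0))] at hk
    exact hk.eventually (gt_mem_nhds (by linarith))
  filter_upwards [hspec, hq_diag k, hq_diag m,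
    (h.tendsto_inner_aeval p k m).eventually (Metric.ball_mem_nhds _ (by positivity : 0 < ε / 4))]
    with i hi hik him hp
  have hproj := norm_inner_spectralProjection_sub_aeval_le (hT i) (fun μ hμ => hpq μ (hi μ hμ))
    (e i k) (e i m)
  have hlim_km := hlim (k - m)
  rw [abs_sub_comm, ← Real.norm_eq_abs, ← Complex.norm_real, Complex.ofReal_sub,
    ← dist_eq_norm] at hlim_km
  rw [← dist_eq_norm] at hproj
  refine (dist_triangle4 _ _ _ _).trans_lt
    ((add_le_add (add_le_add hproj hp.le) hlim_km).trans_lt ?_)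
  linarith

end TendstoFreeJacobi

end FreeJacobi

/-! ### Weight vectors near the equator -/

section Equator

/-- The position of the `k`-th vector below the equator in a weight basis of length `n`. It is
meaningful only when `n` is large compared with `k`, since `Int.toNat` truncates at `0`. -/
def equatorIndex (n : ℕ) (k : ℤ) : ℕ := (((n / 2 : ℕ) : ℤ) + k).toNat

theorem natCast_equatorIndex {n : ℕ} {k : ℤ} (hn : 2 * k.natAbs ≤ n) :
    (equatorIndex n k : ℤ) = ((n / 2 : ℕ) : ℤ) + k := by
  unfold equatorIndex
  omega

theorem equatorIndex_add_one {n : ℕ} {k : ℤ} (hn : 2 * k.natAbs ≤ n) :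
    equatorIndex n (k + 1) = equatorIndex n k + 1 := by
  unfold equatorIndex
  omega

theorem equatorIndex_lt {n : ℕ} {k : ℤ} (hn : 2 * k.natAbs < n) : equatorIndex n k < n := by
  unfold equatorIndex
  omega

theorem equatorIndex_inj {n : ℕ} {k m : ℤ} (hk : 2 * k.natAbs ≤ n) (hm : 2 * m.natAbs ≤ n) :
    equatorIndex n k = equatorIndex n m ↔ k = m := by
  unfold equatorIndex
  omega

theorem spinNumber_add_half (n : ℕ) : spinNumber n + 1 / 2 = n / 2 := by
  rw [spinNumber]
  ring

theorem spinNumber_sub_equatorIndex_mem_Icc {n : ℕ} {k : ℤ} (hn : 2 * k.natAbs ≤ n) :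
    spinNumber n - equatorIndex n k ∈ Set.Icc (-k - 1 / 2 : ℝ) (-k) := by
  have hcast : (equatorIndex n k : ℝ) = ((n / 2 : ℕ) : ℝ) + k := by
    rw [← Int.cast_natCast, natCast_equatorIndex hn, Int.cast_add, Int.cast_natCast]
  have hle : 2 * ((n / 2 : ℕ) : ℝ) ≤ n := by exact_mod_cast Nat.mul_div_le n 2
  have hlt : (n : ℝ) ≤ 2 * ((n / 2 : ℕ) : ℝ) + 1 := by exact_mod_cast
    (by omega : n ≤ 2 * (n / 2) + 1)
  rw [hcast, spinNumber]
  constructor <;> linarith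

theorem tendsto_ladderCoeff_equatorIndex (k : ℤ) :
    Tendsto (fun n : ℕ => 2 / (n : ℝ) * ladderCoeff n (equatorIndex n k)) atTop (𝓝 (1 / 2)) := by
  set u : ℕ → ℝ := fun n => spinNumber n - equatorIndex n k - 1 / 2 with hu_def
  have hmem : ∀ᶠ n : ℕ in atTop, u n ∈ Set.Icc (-k - 1 : ℝ) (-k) :=
    (eventually_ge_atTop (2 * k.natAbs)).mono fun n hn => by
      obtain ⟨hlower, hupper⟩ := spinNumber_sub_equatorIndex_mem_Icc hn
      constructor <;> simp only [hu_def] <;> linarith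
  have hu : Tendsto (fun n : ℕ => u n / n) atTop (𝓝 0) :=
    tendsto_bdd_div_atTop_nhds_zero (hmem.mono fun n hn => hn.1) (hmem.mono fun n hn => hn.2)
      tendsto_natCast_atTop_atTop
  have hsqrt : Tendsto (fun n : ℕ => √(1 / 4 - (u n / n) ^ 2)) atTop (𝓝 (1 / 2)) := by
    have hlim := (((hu.pow 2).const_sub (1 / 4))).sqrt
    rwa [show √(1 / 4 - (0 : ℝ) ^ 2) = 1 / 2 by
      rw [Real.sqrt_eq_iff_mul_self_eq_of_pos (by norm_num)]; norm_num] at hlim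
  refine hsqrt.congr' ((eventually_gt_atTop 0).mono fun n hn => ?_)
  have hn' : (0 : ℝ) < n := Nat.cast_pos.mpr hn
  have hprod : ((equatorIndex n k : ℝ) + 1) * (n - 1 - equatorIndex n k) =
      (1 / 4 - (u n / n) ^ 2) * (n : ℝ) ^ 2 := by
    simp only [hu_def, spinNumber]
    field_simp
    ring
  beta_reduce
  rw [ladderCoeff, hprod, Real.sqrt_mul' _ (sq_nonneg _), Real.sqrt_sq hn'.le]
  field_simp

variable {ι : Type*} {l : Filter ι} {V : ι → Type*} [∀ i, NormedAddCommGroup (V i)]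
  [∀ i, InnerProductSpace ℂ (V i)] {Jx Jy Jz : ∀ i, V i →ₗ[ℂ] V i}
  {v : ∀ i, ℕ → V i}

/-- Dividing `Jx` by `dim V / 2` makes its spectrum asymptotically fill `[-1, 1]`. -/
theorem tendstoFreeJacobi_equator (hdim : Tendsto (fun i => finrank ℂ (V i)) l atTop)
    (hv : ∀ᶠ i in l, IsWeightBasis (Jx i) (Jz i) (v i)) :
    TendstoFreeJacobi l (fun i => ((2 / finrank ℂ (V i) : ℝ) : ℂ) • Jx i)
      (fun i k => v i (equatorIndex (finrank ℂ (V i)) k)) := by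
  refine ⟨fun k m => ?_, fun i k => 2 / finrank ℂ (V i) * ladderCoeff _ (equatorIndex _ k),
    fun k => (tendsto_ladderCoeff_equatorIndex k).comp hdim, fun k => ?_⟩
  · filter_upwards [hv, hdim.eventually_gt_atTop (2 * k.natAbs),
      hdim.eventually_gt_atTop (2 * m.natAbs)] with i hi hk hm
    have horth := orthonormal_iff_ite.mp hi.orthonormal ⟨_, equatorIndex_lt hk⟩
      ⟨_, equatorIndex_lt hm⟩
    simpa only [Fin.mk.injEq, equatorIndex_inj hk.le hm.le] using horth
  · filter_upwards [hv, hdim.eventually_ge_atTop (2 * k.natAbs),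
      hdim.eventually_ge_atTop (2 * (k - 1).natAbs)] with i hi hk hk'
    have hsucc := equatorIndex_add_one hk'
    rw [sub_add_cancel] at hsucc
    rw [equatorIndex_add_one hk, hsucc, LinearMap.smul_apply, hi.apply_x, smul_add, smul_smul,
      smul_smul]
    push_cast
    rfl

theorem eventually_spectralProjection_z_equator_of_nonneg [∀ i, FiniteDimensional ℂ (V i)]
    (hdim : Tendsto (fun i => finrank ℂ (V i)) l atTop)
    (hv : ∀ᶠ i in l, IsWeightBasis (Jx i) (Jz i) (v i)) (hJz : ∀ i, (Jz i).IsSymmetric)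
    (r : ι → ℝ) {k : ℤ} (hk : 0 ≤ k) :
    ∀ᶠ i in l, spectralProjection (Jz i) (Set.Ioc 0 (r i))
      (v i (equatorIndex (finrank ℂ (V i)) k)) = 0 := by
  filter_upwards [hv, hdim.eventually_ge_atTop (2 * k.natAbs)] with i hi hdim_i
  refine spectralProjection_apply_of_notMem (hJz i) (fun hmem => ?_) (hi.apply_z _)
  have hk' : (0 : ℝ) ≤ k := by exact_mod_cast hk
  linarith [hmem.1, (spinNumber_sub_equatorIndex_mem_Icc hdim_i).2]

theorem eventually_spectralProjection_z_equator_of_neg [∀ i, FiniteDimensional ℂ (V i)]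
    (hdim : Tendsto (fun i => finrank ℂ (V i)) l atTop)
    (hv : ∀ᶠ i in l, IsWeightBasis (Jx i) (Jz i) (v i)) {r : ι → ℝ} (hr : Tendsto r l atTop)
    {k : ℤ} (hk : k < 0) :
    ∀ᶠ i in l, spectralProjection (Jz i) (Set.Ioc 0 (r i))
      (v i (equatorIndex (finrank ℂ (V i)) k)) = v i (equatorIndex (finrank ℂ (V i)) k) := by
  filter_upwards [hv, hdim.eventually_ge_atTop (2 * k.natAbs), hr.eventually_ge_atTop (-k : ℝ)]
    with i hi hdim_i hri
  obtain ⟨hlower, hupper⟩ := spinNumber_sub_equatorIndex_mem_Icc hdim_i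
  have hk' : (k : ℝ) ≤ -1 := by exact_mod_cast Int.le_sub_one_of_lt hk
  exact spectralProjection_apply_of_mem (Set.mem_Ioc.mpr ⟨by linarith, by linarith⟩) (hi.apply_z _)

theorem abs_le_one_of_hasEigenvalue_two_div_smul {W : Type*} [NormedAddCommGroup W]
    [InnerProductSpace ℂ W] [FiniteDimensional ℂ W] {Ax Ay Az : W →ₗ[ℂ] W}
    (h : IsIrreducibleSpin Ax Ay Az) (hn : 1 < finrank ℂ W) {μ : ℝ}
    (hμ : End.HasEigenvalue (((2 / finrank ℂ W : ℝ) : ℂ) • Ax) (μ : ℂ)) : |μ| ≤ 1 := by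
  set c : ℝ := 2 / finrank ℂ W
  have hn' : (0 : ℝ) < finrank ℂ W := by exact_mod_cast zero_lt_one.trans hn
  have hc : 0 < c := by positivity
  obtain ⟨w, hw⟩ := hμ.exists_hasEigenvector
  have hAx : Ax w = ((μ / c : ℝ) : ℂ) • w := by
    have hc' : (c : ℂ) ≠ 0 := Complex.ofReal_ne_zero.mpr hc.ne'
    rw [← smul_right_inj hc', ← LinearMap.smul_apply, hw.apply_eq_smul, smul_smul,
      ← Complex.ofReal_mul, mul_div_cancel₀ _ hc.ne']
  have hle := h.cyclic.abs_le_of_hasEigenvalue hn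
    (End.hasEigenvalue_of_hasEigenvector ⟨End.mem_eigenspace_iff.mpr hAx, hw.2⟩)
  rw [abs_div, abs_of_pos hc, div_le_iff₀ hc] at hle
  refine hle.trans ?_
  rw [spinNumber, div_mul_div_comm, div_le_one (by positivity)]
  linarith

theorem tendsto_inner_equator_spectralProjection_x [∀ i, FiniteDimensional ℂ (V i)]
    (hJ : ∀ i, IsIrreducibleSpin (Jx i) (Jy i) (Jz i))
    (hdim : Tendsto (fun i => finrank ℂ (V i)) l atTop)
    (hv : ∀ᶠ i in l, IsWeightBasis (Jx i) (Jz i) (v i)) (a : ℝ) (k m : ℤ) :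
    Tendsto (fun i => ⟪v i (equatorIndex (finrank ℂ (V i)) k),
        spectralProjection (Jx i) (Set.Ioi (a * (spinNumber (finrank ℂ (V i)) + 1 / 2)))
          (v i (equatorIndex (finrank ℂ (V i)) m))⟫_ℂ) l
      (𝓝 (cosFourierCoeff ((Set.Ioi a).indicator 1) (k - m) : ℝ)) := by
  have hlarge := hdim.eventually_gt_atTop 1
  refine ((tendstoFreeJacobi_equator hdim hv).tendsto_inner_spectralProjection_Ioi (fun i => ?_)
    (hlarge.mono fun i hi μ hμ => abs_le.mp (abs_le_one_of_hasEigenvalue_two_div_smul (hJ i) hi hμ))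
    a k m).congr' (hlarge.mono fun i hi => ?_)
  · exact (hJ i).symm_x.smul (Complex.conj_ofReal _)
  · have hn : (0 : ℝ) < finrank ℂ (V i) := by exact_mod_cast zero_lt_one.trans hi
    have hc : (0 : ℝ) < 2 / finrank ℂ (V i) := by positivity
    have ha : a / (2 / finrank ℂ (V i)) = a * (spinNumber (finrank ℂ (V i)) + 1 / 2) := by
      rw [spinNumber_add_half]
      field_simp
    rw [spectralProjection_smul hc.ne', Set.preimage_const_mul_Ioi₀ _ hc, ha]

end Equator

/-! ### A Hilbert-type double sum -/

section HilbertForm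

open Finset Real
open scoped ComplexConjugate

/-- The entry `1 / (k + l + 1)` of the Hilbert matrix, weighted by the sequence `1 / √(k + 1)`,
along which the quadratic form of the Hilbert matrix asymptotically attains its norm `π`. -/
noncomputable def hilbertWeight (k l : ℕ) : ℝ := 1 / (√(k + 1) * √(l + 1) * (k + l + 1))

theorem norm_sum_range_smul_le_of_antitone {E : Type*} [SeminormedAddCommGroup E] [NormedSpace ℝ E]
    {a : ℕ → ℝ} {z : ℕ → E} {B : ℝ} (ha : Antitone a) (ha0 : ∀ n, 0 ≤ a n)
    (hz : ∀ m, ‖∑ i ∈ range m, z i‖ ≤ B) (n : ℕ) : ‖∑ i ∈ range n, a i • z i‖ ≤ B * a 0 := by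
  have hsub : ‖∑ i ∈ range n, a i • z i - a n • ∑ i ∈ range n, z i‖ ≤ B * (a 0 - a n) := by
    induction n with
    | zero => simp
    | succ n ih =>
      have hstep : 0 ≤ a n - a (n + 1) := sub_nonneg.mpr (ha n.le_succ)
      calc ‖∑ i ∈ range (n + 1), a i • z i - a (n + 1) • ∑ i ∈ range (n + 1), z i‖
          = ‖(∑ i ∈ range n, a i • z i - a n • ∑ i ∈ range n, z i) +
              (a n - a (n + 1)) • ∑ i ∈ range (n + 1), z i‖ := by
            simp only [sum_range_succ, sub_smul, smul_add]
            congr 1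
            abel
        _ ≤ B * (a 0 - a n) + (a n - a (n + 1)) * B := by
            refine (norm_add_le _ _).trans (add_le_add ih ?_)
            rw [norm_smul, norm_of_nonneg hstep]
            exact mul_le_mul_of_nonneg_left (hz _) hstep
        _ = B * (a 0 - a (n + 1)) := by ring
  have hlast : ‖a n • ∑ i ∈ range n, z i‖ ≤ B * a n := by
    rw [norm_smul, norm_of_nonneg (ha0 n), mul_comm]
    exact mul_le_mul_of_nonneg_right (hz n) (ha0 n)
  linarith [norm_le_norm_sub_add (∑ i ∈ range n, a i • z i) (a n • ∑ i ∈ range n, z i)]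

theorem norm_geom_sum_le {K : Type*} [NormedField K] {ζ : K} (hζ : ‖ζ‖ = 1) (hζ1 : ζ ≠ 1) (m : ℕ) :
    ‖∑ i ∈ range m, ζ ^ i‖ ≤ 2 / ‖ζ - 1‖ := by
  rw [geom_sum_eq hζ1, norm_div]
  gcongr
  refine (norm_sub_le _ _).trans_eq ?_
  rw [norm_pow, hζ, one_pow, norm_one]
  norm_num

theorem exists_sum_hilbertWeight_zero_le : ∃ C, ∀ n, ∑ k ∈ range n, hilbertWeight k 0 ≤ C := by
  have hsum : Summable fun k : ℕ => hilbertWeight k 0 := by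
    refine ((summable_nat_add_iff 1).mpr
      (summable_one_div_nat_rpow.mpr (by norm_num : (1 : ℝ) < 1 / 2 + 1))).congr fun k => ?_
    have hk : (0 : ℝ) < (k : ℝ) + 1 := by positivity
    rw [Nat.cast_add_one, rpow_add hk, rpow_one, ← sqrt_eq_rpow, hilbertWeight]
    simp
  exact ⟨_, fun n => hsum.sum_le_tsum _ fun k _ => by rw [hilbertWeight]; positivity⟩

theorem exists_norm_sum_hilbertWeight_smul_pow_le {K : Type*} [NormedField K] [NormedAlgebra ℝ K]
    {ζ : K} (hζ : ‖ζ‖ = 1) (hζ1 : ζ ≠ 1) :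
    ∃ C, ∀ n, ‖∑ k ∈ range n, ∑ l ∈ range n, hilbertWeight k l • ζ ^ (k + l + 1)‖ ≤ C := by
  obtain ⟨C, hC⟩ := exists_sum_hilbertWeight_zero_le
  refine ⟨2 / ‖ζ - 1‖ * C, fun n => ?_⟩
  have hrow (k : ℕ) :
      ‖∑ l ∈ range n, hilbertWeight k l • ζ ^ (k + l + 1)‖ ≤ 2 / ‖ζ - 1‖ * hilbertWeight k 0 := by
    have hanti : Antitone (hilbertWeight k) := fun l l' hl => by
      unfold hilbertWeight
      gcongr
    calc ‖∑ l ∈ range n, hilbertWeight k l • ζ ^ (k + l + 1)‖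
        = ‖ζ ^ (k + 1) * ∑ l ∈ range n, hilbertWeight k l • ζ ^ l‖ := by
          rw [mul_sum]
          congr 1
          exact sum_congr rfl fun l _ => by rw [mul_smul_comm, ← pow_add, add_right_comm]
      _ = ‖∑ l ∈ range n, hilbertWeight k l • ζ ^ l‖ := by
          rw [norm_mul, norm_pow, hζ, one_pow, one_mul]
      _ ≤ 2 / ‖ζ - 1‖ * hilbertWeight k 0 :=
          norm_sum_range_smul_le_of_antitone hanti
            (fun l => by rw [hilbertWeight]; positivity) (norm_geom_sum_le hζ hζ1) n
  calc _ ≤ ∑ k ∈ range n, 2 / ‖ζ - 1‖ * hilbertWeight k 0 := norm_sum_le_of_le _ fun k _ => hrow k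
    _ ≤ 2 / ‖ζ - 1‖ * C := by
      rw [← mul_sum]
      exact mul_le_mul_of_nonneg_left (hC n) (by positivity)

theorem sum_range_one_div_sqrt_add_one_le (n : ℕ) :
    ∑ k ∈ range n, 1 / √((k : ℝ) + 1) ≤ 2 * √n := by
  induction n with
  | zero => simp
  | succ n ih =>
    have hstep : 1 / √((n : ℝ) + 1) ≤ 2 * √((n : ℝ) + 1) - 2 * √n := by
      rw [div_le_iff₀ (by positivity)]
      nlinarith [sq_nonneg (√((n : ℝ) + 1) - √n), sq_sqrt (Nat.cast_nonneg (α := ℝ) n),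
        sq_sqrt (Nat.cast_add_one_pos (α := ℝ) n).le]
    rw [sum_range_succ, Nat.cast_add_one]
    linarith

theorem arctan_le_self {x : ℝ} (hx : 0 ≤ x) : arctan x ≤ x := by
  simpa only [tan_arctan] using le_tan (arctan_nonneg.mpr hx) (arctan_lt_pi_div_two x)

theorem pi_div_two_sub_inv_le_arctan {x : ℝ} (hx : 0 < x) : π / 2 - x⁻¹ ≤ arctan x := by
  have harctan := arctan_le_self (inv_nonneg.mpr hx.le)
  rw [arctan_inv_of_pos hx] at harctan
  linarith

theorem hasDerivAt_two_div_sqrt_mul_arctan {K t : ℝ} (hK : 0 < K) (ht : 0 < t) :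
    HasDerivAt (fun t => 2 / √K * arctan (√(t / K))) (1 / (√t * (t + K))) t := by
  refine ((((hasDerivAt_id t).div_const K).sqrt (div_pos ht hK).ne').arctan.const_mul
    (2 / √K)).congr_deriv ?_
  rw [id, sq_sqrt (div_pos ht hK).le, sqrt_div ht.le]
  field_simp
  ring

theorem integral_one_div_sqrt_mul_add {K x y : ℝ} (hK : 0 < K) (hx : 0 < x) (hxy : x ≤ y) :
    ∫ t in x..y, 1 / (√t * (t + K)) =
      2 / √K * (arctan (√(y / K)) - arctan (√(x / K))) := by
  have hpos {t : ℝ} (ht : t ∈ Set.uIcc x y) : 0 < t := by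
    rw [Set.uIcc_of_le hxy] at ht
    exact hx.trans_le ht.1
  rw [mul_sub]
  refine intervalIntegral.integral_eq_sub_of_hasDerivAt
    (fun t ht => hasDerivAt_two_div_sqrt_mul_arctan hK (hpos ht))
    (ContinuousOn.intervalIntegrable fun t ht => ?_)
  have hden : √t * (t + K) ≠ 0 := by
    have := hpos ht
    positivity
  exact ContinuousAt.continuousWithinAt (by fun_prop (disch := exact hden))

theorem integral_le_sqrt_mul_sum_hilbertWeight (n k : ℕ) :
    ∫ t in (1 : ℝ)..1 + n, 1 / (√t * (t + (k + 1))) ≤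
      √(k + 1) * ∑ l ∈ range n, hilbertWeight k l := by
  refine (AntitoneOn.integral_le_sum fun s hs t _ hst => ?_).trans ?_
  · have hs : 0 < s := zero_lt_one.trans_le hs.1
    gcongr
  · rw [mul_sum]
    refine sum_le_sum fun l _ => ?_
    calc 1 / (√(1 + l) * (1 + l + (k + 1)))
        ≤ 1 / (√(l + 1) * (k + l + 1)) := by
          rw [add_comm 1 (l : ℝ)]
          gcongr 1 / (_ * ?_)
          linarith
      _ = √(k + 1) * hilbertWeight k l := by
          rw [hilbertWeight]
          field_simp

theorem pi_div_sub_le_sum_hilbertWeight (n k : ℕ) :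
    π / (k + 1) - 2 / √(n + 1) * (1 / √(k + 1)) - 2 * hilbertWeight k 0 ≤
      ∑ l ∈ range n, hilbertWeight k l := by
  set K : ℝ := k + 1 with hK_def
  have hK : 0 < K := by positivity
  have hsqrt : √K * √K = K := mul_self_sqrt hK.le
  have hlower : π / 2 - √K / √(1 + n) ≤ arctan (√((1 + n) / K)) := by
    have harctan := pi_div_two_sub_inv_le_arctan (x := √((n + 1) / K)) (by positivity)
    rwa [← sqrt_inv, inv_div, sqrt_div hK.le, add_comm (n : ℝ)] at harctan
  have hupper : arctan (√(1 / K)) ≤ 1 / √K := by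
    simpa using arctan_le_self (sqrt_nonneg (1 / K))
  have hsum := integral_le_sqrt_mul_sum_hilbertWeight n k
  rw [integral_one_div_sqrt_mul_add hK one_pos (by simp)] at hsum
  calc π / K - 2 / √(n + 1) * (1 / √K) - 2 * hilbertWeight k 0
      = 1 / √K * (2 / √K * (π / 2 - √K / √(1 + n) - 1 / √K)) := by
        rw [hilbertWeight, add_comm 1 (n : ℝ), Nat.cast_zero, zero_add, sqrt_one, add_zero,
          ← hK_def, mul_one]
        field_simp
        linear_combination (π * √(n + 1) * √K - 2 * √(n + 1)) * hsqrt
    _ ≤ 1 / √K * (2 / √K * (arctan (√((1 + n) / K)) - arctan (√(1 / K)))) := by gcongr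
    _ ≤ 1 / √K * (√K * ∑ l ∈ range n, hilbertWeight k l) := by gcongr
    _ = ∑ l ∈ range n, hilbertWeight k l := by field_simp

theorem exists_pi_mul_sum_sub_le_sum_hilbertWeight :
    ∃ C, ∀ n, π * ∑ k ∈ range n, 1 / ((k : ℝ) + 1) - C ≤
      ∑ k ∈ range n, ∑ l ∈ range n, hilbertWeight k l := by
  obtain ⟨C, hC⟩ := exists_sum_hilbertWeight_zero_le
  refine ⟨4 + 2 * C, fun n => ?_⟩
  have herror : 2 / √(n + 1) * ∑ k ∈ range n, 1 / √((k : ℝ) + 1) ≤ 4 := by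
    have hsum := sum_range_one_div_sqrt_add_one_le n
    refine (mul_le_mul_of_nonneg_left hsum (by positivity)).trans ?_
    rw [div_mul_eq_mul_div, div_le_iff₀ (by positivity)]
    linarith [sqrt_le_sqrt (le_add_of_nonneg_right zero_le_one : (n : ℝ) ≤ n + 1)]
  refine le_trans ?_ (sum_le_sum fun k _ => pi_div_sub_le_sum_hilbertWeight n k)
  simp only [sum_sub_distrib, ← mul_sum, div_eq_mul_one_div π]
  linarith [hC n]

/-- Coefficients of the vectors on which the commutator is tested: the weights `1 / √(k + 1)` of the
Hilbert form, with phases that turn the factor `sin (s * α)`, where `s = k + l + 1`, into a multiple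
of `exp (2 * s * α * I) - 1`, whose first term oscillates and contributes a bounded amount. -/
noncomputable def trialCoeff (α : ℝ) (k : ℕ) : ℂ :=
  Complex.exp ((α * (k + 1 / 2) : ℝ) * Complex.I) / √(k + 1)

theorem norm_trialCoeff_sq (α : ℝ) (k : ℕ) : ‖trialCoeff α k‖ ^ 2 = 1 / ((k : ℝ) + 1) := by
  rw [trialCoeff, norm_div, Complex.norm_exp_ofReal_mul_I, Complex.norm_real, norm_eq_abs, div_pow,
    sq_abs, sq_sqrt (by positivity), one_pow]

theorem trialCoeff_mul_trialCoeff_mul_sin (α : ℝ) (k l : ℕ) :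
    trialCoeff α k * trialCoeff α l * (sin ((k + l + 1) * α) / (π * (k + l + 1)) : ℝ) =
      (2 * π * Complex.I)⁻¹ * (hilbertWeight k l *
        (Complex.exp ((2 * α : ℝ) * Complex.I) ^ (k + l + 1) - 1)) := by
  set x : ℂ := (((k + l + 1) * α : ℝ) : ℂ) with hx_def
  have hphase : Complex.exp ((α * (k + 1 / 2) : ℝ) * Complex.I) *
      Complex.exp ((α * (l + 1 / 2) : ℝ) * Complex.I) = Complex.exp (x * Complex.I) := by
    rw [← Complex.exp_add]
    congr 1
    push_cast [hx_def]
    ring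
  have hpow : Complex.exp ((2 * α : ℝ) * Complex.I) ^ (k + l + 1) =
      Complex.exp (x * Complex.I) * Complex.exp (x * Complex.I) := by
    rw [← Complex.exp_nat_mul, ← Complex.exp_add]
    congr 1
    push_cast [hx_def]
    ring
  have hsin : Complex.exp (x * Complex.I) * (2 * Complex.I * Complex.sin x) =
      Complex.exp (x * Complex.I) * Complex.exp (x * Complex.I) - 1 := by
    have hinv : Complex.exp (x * Complex.I) * Complex.exp (-x * Complex.I) = 1 := by
      rw [← Complex.exp_add, neg_mul, add_neg_cancel, Complex.exp_zero]
    linear_combination (Complex.I * Complex.exp (x * Complex.I)) * Complex.two_sin x - hinv +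
      (Complex.exp (x * Complex.I) * Complex.exp (-x * Complex.I) -
        Complex.exp (x * Complex.I) ^ 2) * Complex.I_sq
  rw [hpow, trialCoeff, trialCoeff, div_mul_div_comm, hphase, ← hsin, hilbertWeight,
    Complex.ofReal_div, Complex.ofReal_sin, ← hx_def]
  push_cast
  field_simp

theorem exists_half_mul_sum_sub_le_norm_sum_trialCoeff {α : ℝ} (hα : sin α ≠ 0) :
    ∃ C, ∀ n, 1 / 2 * ∑ k ∈ range n, 1 / ((k : ℝ) + 1) - C ≤
      ‖∑ k ∈ range n, ∑ l ∈ range n,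
        trialCoeff α k * trialCoeff α l * (sin ((k + l + 1) * α) / (π * (k + l + 1)) : ℝ)‖ := by
  set ζ : ℂ := Complex.exp ((2 * α : ℝ) * Complex.I)
  have hζ1 : ζ ≠ 1 := fun h => hα <| by
    have hcos := congrArg Complex.re h
    rw [Complex.exp_ofReal_mul_I_re, Complex.one_re, cos_two_mul, cos_sq'] at hcos
    exact pow_eq_zero_iff two_ne_zero |>.mp (by linarith)
  obtain ⟨C₁, hmain⟩ := exists_pi_mul_sum_sub_le_sum_hilbertWeight
  obtain ⟨C₂, hosc⟩ :=
    exists_norm_sum_hilbertWeight_smul_pow_le (Complex.norm_exp_ofReal_mul_I (2 * α)) hζ1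
  refine ⟨(C₁ + C₂) / (2 * π), fun n => ?_⟩
  set S : ℝ := ∑ k ∈ range n, ∑ l ∈ range n, hilbertWeight k l
  set T : ℂ := ∑ k ∈ range n, ∑ l ∈ range n, hilbertWeight k l • ζ ^ (k + l + 1)
  have hform : ∑ k ∈ range n, ∑ l ∈ range n,
      trialCoeff α k * trialCoeff α l * (sin ((k + l + 1) * α) / (π * (k + l + 1)) : ℝ) =
        (2 * π * Complex.I)⁻¹ * (T - S) := by
    simp only [trialCoeff_mul_trialCoeff_mul_sin, mul_sub_one, ← mul_sum, sum_sub_distrib, S, T,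
      Complex.ofReal_sum, ζ, Complex.real_smul]
  have hST : S - C₂ ≤ ‖T - S‖ := by
    have hnorm := norm_sub_norm_le (S : ℂ) T
    rw [norm_sub_rev] at hnorm
    linarith [hosc n, (le_abs_self S).trans_eq (Complex.norm_real S).symm]
  rw [hform, norm_mul, norm_inv, norm_mul, norm_mul, Complex.norm_I, Complex.norm_two,
    Complex.norm_of_nonneg pi_pos.le, mul_one]
  calc 1 / 2 * ∑ k ∈ range n, 1 / ((k : ℝ) + 1) - (C₁ + C₂) / (2 * π)
      = (2 * π)⁻¹ * (π * ∑ k ∈ range n, 1 / ((k : ℝ) + 1) - C₁ - C₂) := by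
        field_simp
        ring
    _ ≤ (2 * π)⁻¹ * ‖T - S‖ := by
        gcongr
        linarith [hmain n]

theorem exists_mul_sum_lt_norm_sum_trialCoeff {α r : ℝ} (hα : sin α ≠ 0) (hr : r < 1 / 2) :
    ∃ n, r * ∑ k ∈ range n, 1 / ((k : ℝ) + 1) <
      ‖∑ k ∈ range n, ∑ l ∈ range n,
        trialCoeff α k * trialCoeff α l * (sin ((k + l + 1) * α) / (π * (k + l + 1)) : ℝ)‖ := by
  obtain ⟨C, hC⟩ := exists_half_mul_sum_sub_le_norm_sum_trialCoeff hα
  obtain ⟨n, hn⟩ := (tendsto_sum_range_one_div_nat_succ_atTop.eventually_gt_atTop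
    (C / (1 / 2 - r))).exists
  rw [div_lt_iff₀ (sub_pos.mpr hr)] at hn
  exact ⟨n, (by linarith : _ < _).trans_le (hC n)⟩

end HilbertForm

/-! ### The norm of the commutator -/

section CommutatorNorm

open scoped ComplexConjugate

theorem norm_sum_smul_of_orthonormal {𝕜 E κ : Type*} [RCLike 𝕜] [NormedAddCommGroup E]
    [InnerProductSpace 𝕜 E] [Fintype κ] {f : κ → E} (hf : Orthonormal 𝕜 f) (x : κ → 𝕜) :
    ‖∑ k, x k • f k‖ = √(∑ k, ‖x k‖ ^ 2) := by
  rw [@norm_eq_sqrt_re_inner 𝕜, hf.inner_sum]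
  simp only [RCLike.conj_mul, map_sum]
  norm_cast

theorem eventually_lt_norm_commutator {𝕜 ι κ κ' : Type*} [RCLike 𝕜] {l : Filter ι} {E : ι → Type*}
    [∀ i, NormedAddCommGroup (E i)] [∀ i, InnerProductSpace 𝕜 (E i)] [Fintype κ] [Fintype κ']
    {P Q : ∀ i, E i →L[𝕜] E i} (hQ : ∀ i, (Q i).IsSymmetric) {f : ∀ i, κ → E i} {g : ∀ i, κ' → E i}
    (hf : ∀ᶠ i in l, Orthonormal 𝕜 (f i)) (hg : ∀ᶠ i in l, Orthonormal 𝕜 (g i))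
    (hQf : ∀ k, ∀ᶠ i in l, Q i (f i k) = 0) (hQg : ∀ m, ∀ᶠ i in l, Q i (g i m) = g i m)
    {M : κ → κ' → 𝕜} (hP : ∀ k m, Tendsto (fun i => ⟪f i k, P i (g i m)⟫_𝕜) l (𝓝 (M k m)))
    {x : κ → 𝕜} {y : κ' → 𝕜} {r : ℝ}
    (hr : r * (√(∑ k, ‖x k‖ ^ 2) * √(∑ m, ‖y m‖ ^ 2)) < ‖∑ k, ∑ m, conj (x k) * y m * M k m‖) :
    ∀ᶠ i in l, r < ‖P i * Q i - Q i * P i‖ := by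
  have hlim : Tendsto (fun i => ⟪∑ k, x k • f i k, P i (∑ m, y m • g i m)⟫_𝕜) l
      (𝓝 (∑ k, ∑ m, conj (x k) * y m * M k m)) := by
    refine (tendsto_finsetSum _ fun k _ => tendsto_finsetSum _ fun m _ =>
      (hP k m).const_mul (conj (x k) * y m)).congr fun i => ?_
    simp only [sum_inner, inner_smul_left, mul_assoc]
    simp only [map_sum, map_smul, inner_sum, inner_smul_right, Finset.mul_sum]
  filter_upwards [hf, hg, eventually_all.mpr hQf, eventually_all.mpr hQg,
    hlim.norm.eventually_const_lt hr] with i hf hg hQf hQg hlt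
  have hle := norm_inner_le_norm_commutator_mul (P := P i) (hQ i) (x := ∑ k, x k • f i k)
    (y := ∑ m, y m • g i m) (by simp [hQf]) (by simp [hQg])
  rw [norm_sum_smul_of_orthonormal hf, norm_sum_smul_of_orthonormal hg] at hle
  exact lt_of_mul_lt_mul_right (hlt.trans_le hle) (by positivity)

variable {ι : Type*} {l : Filter ι} {V : ι → Type*} [∀ i, NormedAddCommGroup (V i)]
  [∀ i, InnerProductSpace ℂ (V i)] [∀ i, FiniteDimensional ℂ (V i)]
  {Jx Jy Jz : ∀ i, V i →ₗ[ℂ] V i}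

theorem eventually_lt_norm_spinCommutator {a b r : ℝ} (ha : a ∈ Set.Ioo (-1) 1) (hb : 0 < b)
    (hr : r < 1 / 2) (hJ : ∀ i, IsIrreducibleSpin (Jx i) (Jy i) (Jz i))
    (hdim : Tendsto (fun i => finrank ℂ (V i)) l atTop) :
    ∀ᶠ i in l, r < ‖spinCommutator a b (Jx i) (Jz i)‖ := by
  choose! v hv using fun i (hi : 1 < finrank ℂ (V i)) => (hJ i).exists_isWeightBasis hi
  have hv := (hdim.eventually_gt_atTop 1).mono hv
  have hsin : Real.sin (Real.arccos a) ≠ 0 := by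
    rw [Real.sin_arccos]
    exact (Real.sqrt_pos.mpr (by nlinarith [ha.1, ha.2])).ne'
  obtain ⟨n, hn⟩ := exists_mul_sum_lt_norm_sum_trialCoeff hsin hr
  have hradius : Tendsto (fun i => b * (spinNumber (finrank ℂ (V i)) + 1 / 2)) l atTop := by
    simp only [spinNumber_add_half]
    exact ((tendsto_natCast_atTop_atTop.comp hdim).atTop_div_const two_pos).const_mul_atTop hb
  have hfree := tendstoFreeJacobi_equator hdim hv
  refine eventually_lt_norm_commutator (fun i => Submodule.starProjection_isSymmetric _)
    (hfree.eventually_orthonormal (κ := Fin n) (j := fun k => (k : ℤ)) fun k m h => by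
      simpa [Fin.ext_iff] using h)
    (hfree.eventually_orthonormal (κ := Fin n) (j := fun k => -(k + 1 : ℤ)) fun k m h => by
      simpa [Fin.ext_iff] using h)
    (fun k => eventually_spectralProjection_z_equator_of_nonneg hdim hv (fun i => (hJ i).symm_z) _
      (by positivity))
    (fun k => eventually_spectralProjection_z_equator_of_neg hdim hv hradius (by omega))
    (fun k m => tendsto_inner_equator_spectralProjection_x hJ hdim hv a _ _)
    (x := fun k => conj (trialCoeff (Real.arccos a) k)) (y := fun k => trialCoeff (Real.arccos a) k)
    ?_
  have hM (k m : Fin n) : cosFourierCoeff ((Set.Ioi a).indicator 1) ((k : ℤ) - -(m + 1 : ℤ)) =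
      Real.sin ((k + m + 1) * Real.arccos a) / (Real.pi * (k + m + 1)) := by
    rw [cosFourierCoeff_indicator_Ioi ⟨ha.1.le, ha.2.le⟩ (by omega), sub_neg_eq_add, ← add_assoc]
    push_cast
    rfl
  simp only [Finset.sum_range] at hn
  rw [← Real.mul_self_sqrt (by positivity : 0 ≤ ∑ k : Fin n, 1 / ((k : ℝ) + 1))] at hn
  simpa only [hM, RCLike.norm_conj, RCLike.conj_conj, norm_trialCoeff_sq] using hn

theorem mainTheorem3_general {a b : ℝ} (ha : a ∈ Set.Ioo (-1) 1) (hb : 0 < b)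
    (hJ : ∀ i, IsIrreducibleSpin (Jx i) (Jy i) (Jz i))
    (hdim : Tendsto (fun i => finrank ℂ (V i)) l atTop) :
    Tendsto (fun i => ‖spinCommutator a b (Jx i) (Jz i)‖) l (𝓝 (1 / 2)) :=
  tendsto_order.mpr ⟨fun _ hr => eventually_lt_norm_spinCommutator ha hb hr hJ hdim,
    fun _ hr => .of_forall fun _ => (norm_commutator_starProjection_le _ _).trans_lt hr⟩

end CommutatorNorm

theorem mainTheorem3 (a b : ℝ) (ha : a ∈ Set.Ico (0 : ℝ) 1) (hb : b ∈ Set.Ioc (0 : ℝ) 1)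
    (V : ℕ → Type*) [∀ n, NormedAddCommGroup (V n)] [∀ n, InnerProductSpace ℂ (V n)]
    [∀ n, FiniteDimensional ℂ (V n)] (hV : ∀ n, 1 ≤ n → Module.finrank ℂ (V n) = n)
    (Jx Jy Jz : ∀ n, V n →ₗ[ℂ] V n)
    (hJ : ∀ n, 1 ≤ n → IsIrreducibleSpin (Jx n) (Jy n) (Jz n)) :
    Filter.Tendsto (fun n : ℕ => ‖spinCommutator a b (Jx n) (Jz n)‖) Filter.atTop
      (nhds (1 / 2)) := by
  have hdim : Tendsto (fun n => finrank ℂ (V (n + 1))) atTop atTop :=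
    (tendsto_add_atTop_nat 1).congr fun n => (hV (n + 1) n.succ_pos).symm
  exact (tendsto_add_atTop_iff_nat 1).mp <| mainTheorem3_general ⟨by linarith [ha.1], ha.2⟩ hb.1
    (fun n => hJ (n + 1) n.succ_pos) hdim
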